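/- Let $d\ge 1$ and let $1\le b_i\le M_i$ ($i=1,\dots,d$) be integers. Put $\Lambda=\prod_{i=1}^d[1,M_i]$, $B=\prod_{i=1}^d[1,b_i]$ and $\Delta=\prod_{i=1}^d[0,M_i-b_i]$, all understood as subsets of $\mathbb{Z}^d$, and write $|\cdot|$ for the $1$-norm on $\mathbb{Z}^d$. Let $q:\mathbb{Z}^d\to\mathbb{R}$ be supported in $B$ and satisfy (H1) $q(x_1,\dots,x_i,\dots,x_d)=q(x_1,\dots,b_i-x_i+1,\dots,x_d)$ for all $x\in\mathbb{Z}^d$ and all $i\in\{1,\dots,d\}$. For $a\in\mathbb{Z}^d$ let $q_a(n)=q(n-a)$. Let $h_0$ be the operator $(h_0u)(n)=-\sum_{|m-n|=1}u(m)$ on $\ell^2(\mathbb{Z}^d)$. For $\omega=(\omega_k)_{k\in\mathbb{Z}^d}\in\Omega:=\Delta^{\mathbb{Z}^d}$ let $$V_\omega=\sum_{k\in\mathbb{Z}^d}q_{kM+\omega_k},\qquad kM:=(k_iM_i)_{i=1}^d,\qquad h_\omega=h_0+V_\omega ,$$ a bounded self-adjoint operator on $\ell^2(\mathbb{Z}^d)$,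 and let $$E_{\min}=\inf_{\omega\in\Omega}\min\sigma(h_\omega),\qquad E_{\max}=\sup_{\omega\in\Omega}\max\sigma(h_\omega).$$ Let $h^N_{0,\Lambda}$ be the discrete Neumann Laplacian on $\ell^2(\Lambda)$, that is, the operator with off-diagonal matrix elements $-1$ for $i,j\in\Lambda$ with $|i-j|=1$ and $0$ for all other $i\neq j$, and with diagonal elements $-\#\{j\in\mathbb{Z}^d\setminus\Lambda:|i-j|=1\}$. For $a\in\Delta$ let $$E_0(a)=\min\sigma(h^N_{0,\Lambda}+q_a),\qquad \tilde E_0(a)=\min\sigma(h^N_{0,\Lambda}-q_a).$$ Call $q$ sign-definite if $q\ge 0$ everywhere or $q\le 0$ everywhere. Let $\omega^*\in\Omega$ be the configuration with $(\omega^*_k)_i=0$ if $k_i$ is even and $(\omega^*_k)_i=M_i-b_i$ if $k_i$ is odd. (a) If either (i) $d\ge 2$ and $q$ is sign-definite, or (ii) $d=1$ and $E_0(a)\ne -2$ for at least one $a\in\Delta$, then $\omega^*$ is spectrally minimizing: $\min\sigma(h_{\omega^*})=E_{\min}$. (b) If either (i) $d\ge 2$ and $q$ is sign-definite, or (ii)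 $d=1$ and $\tilde E_0(a)\ne -2$ for at least one $a\in\Delta$, then $\omega^*$ is spectrally maximizing: $\max\sigma(h_{\omega^*})=E_{\max}$. -/

import Mathlib

noncomputable section

namespace DiscreteDisplacement

/-- The lattice `ℤ^d`. -/
abbrev Lattice (d : ℕ) : Type := Fin d → ℤ

/-- The `1`-norm of a lattice vector. -/
def normOne {d : ℕ} (k : Lattice d) : ℤ := ∑ i, |k i|

/-- The Hilbert space `ℓ²(ℤ^d)` (complex valued). -/
abbrev Hilb (d : ℕ) : Type := lp (fun _ : Lattice d => ℂ) 2

/-! ### The discrete Laplacian on `ℓ²(ℤ^d)` -/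

theorem summable_shift {d : ℕ} (v : Lattice d) (u : Hilb d) :
    Memℓp (fun n : Lattice d => u (n + v)) 2 := by
  have h := (memℓp_gen_iff (p := 2) (by norm_num)).1 (lp.memℓp u)
  exact (memℓp_gen_iff (p := 2) (by norm_num)).2
    ((Equiv.addRight v).summable_iff (f := fun n => ‖u n‖ ^ (2 : ENNReal).toReal) |>.2 h)

/-- The shift `(S_v u)(n) = u(n + v)`, an isometry of `ℓ²(ℤ^d)`. -/
def shift {d : ℕ} (v : Lattice d) : Hilb d →ₗᵢ[ℂ] Hilb d where
  toFun u := ⟨fun n => u (n + v), summable_shift v u⟩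
  map_add' _ _ := rfl
  map_smul' _ _ := rfl
  norm_map' u := by
    have h2 : 0 < (2 : ENNReal).toReal := by norm_num
    rw [lp.norm_eq_tsum_rpow h2, lp.norm_eq_tsum_rpow h2]
    congr 1
    exact (Equiv.addRight v).tsum_eq (fun n => ‖u n‖ ^ (2 : ENNReal).toReal)

/-- The (negative) discrete Laplacian `(h₀ u)(n) = - ∑_{|m - n| = 1} u(m)`, written as minus the
sum of the shifts by the `2d` unit vectors `± e_i`; see `freeLaplacian_apply`. -/
def freeLaplacian (d : ℕ) : Hilb d →L[ℂ] Hilb d :=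
  -∑ i : Fin d, ((shift (Pi.single i 1)).toContinuousLinearMap +
    (shift (-Pi.single i 1)).toContinuousLinearMap)

theorem normOne_eq_one_iff {d : ℕ} (k : Lattice d) :
    normOne k = 1 ↔ ∃ i, k = Pi.single i 1 ∨ k = -Pi.single i 1 := by
  constructor
  · intro h
    have hex : ∃ i, k i ≠ 0 := by
      by_contra! h0
      simp [normOne, h0] at h
    obtain ⟨i, hi⟩ := hex
    have hs : |k i| + ∑ j ∈ Finset.univ.erase i, |k j| = 1 := by
      rw [Finset.add_sum_erase Finset.univ (fun j => |k j|) (Finset.mem_univ i)]; exact h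
    have hnn : 0 ≤ ∑ j ∈ Finset.univ.erase i, |k j| :=
      Finset.sum_nonneg fun _ _ => abs_nonneg _
    have hpos : 0 < |k i| := abs_pos.2 hi
    have h1 : |k i| = 1 := by omega
    have h0 : ∑ j ∈ Finset.univ.erase i, |k j| = 0 := by omega
    have hz : ∀ j, j ≠ i → k j = 0 := fun j hj => by
      have := (Finset.sum_eq_zero_iff_of_nonneg (fun _ _ => abs_nonneg _)).1 h0 j
        (Finset.mem_erase.2 ⟨hj, Finset.mem_univ j⟩)
      exact abs_eq_zero.1 this
    refine ⟨i, ?_⟩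
    rcases (abs_eq (by norm_num)).1 h1 with h1 | h1
    · left
      ext j
      by_cases hj : j = i
      · subst hj; simp [h1]
      · simp [hj, hz j hj]
    · right
      ext j
      by_cases hj : j = i
      · subst hj; simp [h1]
      · simp [hj, hz j hj]
  · have hsingle : ∀ i : Fin d, normOne (Pi.single i (1 : ℤ) : Lattice d) = 1 := fun i => by
      unfold normOne
      rw [Finset.sum_eq_single i] <;> simp +contextual
    rintro ⟨i, rfl | rfl⟩
    · exact hsingle i
    · have h := hsingle i
      unfold normOne at h ⊢
      simpa only [Pi.neg_apply, abs_neg] using h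

theorem freeLaplacian_apply {d : ℕ} (u : Hilb d) (n : Lattice d) :
    freeLaplacian d u n = -∑ᶠ m ∈ {m : Lattice d | normOne (m - n) = 1}, u m := by
  classical
  have hset : {m : Lattice d | normOne (m - n) = 1} =
      ((Finset.univ.image fun i : Fin d => n + Pi.single i 1) ∪
        (Finset.univ.image fun i : Fin d => n + -Pi.single i 1) : Finset (Lattice d)) := by
    ext m
    simp only [Set.mem_ofPred_eq, normOne_eq_one_iff, Finset.coe_union, Finset.coe_image,
      Finset.coe_univ, Set.image_univ, Set.mem_union, Set.mem_range, ← exists_or]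
    refine exists_congr fun i => or_congr ?_ ?_
    · rw [sub_eq_iff_eq_add', eq_comm]
    · rw [sub_eq_iff_eq_add', eq_comm]
  have hdisj : Disjoint (Finset.univ.image fun i : Fin d => n + Pi.single i (1 : ℤ))
      (Finset.univ.image fun i : Fin d => n + -Pi.single i (1 : ℤ)) := by
    rw [Finset.disjoint_left]
    intro m hm hm'
    obtain ⟨i, -, rfl⟩ := Finset.mem_image.1 hm
    obtain ⟨j, -, hj⟩ := Finset.mem_image.1 hm'
    have := congrFun (add_left_cancel hj) i
    by_cases hij : i = j
    · subst hij; simp at this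
    · simp [hij] at this
  have hinj : ∀ c : ℤ, c ≠ 0 →
      Function.Injective fun i : Fin d => n + (Pi.single i c : Lattice d) := by
    intro c hc i j hij
    have := congrFun (add_left_cancel hij) i
    by_contra hne
    simp [hne, hc] at this
  rw [hset, finsum_mem_coe_finset, Finset.sum_union hdisj,
    Finset.sum_image (fun i _ j _ h => hinj 1 (by norm_num) h),
    Finset.sum_image (fun i _ j _ h => hinj (-1) (by norm_num) (by simpa [Pi.single_neg] using h)),
    ← Finset.sum_add_distrib]
  unfold freeLaplacian
  rw [neg_apply, sum_apply, lp.coeFn_neg, Pi.neg_apply, lp.coeFn_sum,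
    Finset.sum_apply]
  rfl

/-! ### The Neumann Laplacian on a finite set -/

/-- The edge counting function `n_Λ(i) = #{j ∉ Λ : |i - j| = 1}`, for `i ∈ Λ`. -/
def edgeCount {d : ℕ} (Λ : Finset (Lattice d)) (i : Lattice d) : ℕ :=
  Set.ncard {j : Lattice d | j ∉ Λ ∧ normOne (i - j) = 1}

/-- The Neumann Laplacian on a finite set `Λ ⊂ ℤ^d`: the truncation of the discrete Laplacian to
`Λ` minus the (diagonal) edge counting operator, as a matrix indexed by `Λ`. -/
def neumannLaplacian {d : ℕ} (Λ : Finset (Lattice d)) : Matrix Λ Λ ℝ :=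
  Matrix.of (fun i j : Λ => if normOne (i.1 - j.1) = 1 then (-1 : ℝ) else 0) -
    Matrix.diagonal fun i : Λ => (edgeCount Λ i.1 : ℝ)

/-- `min σ(h^N_{0,Λ} + W)` for a finite set `Λ` and a potential `W`. The matrix is real symmetric,
so for nonempty `Λ` its spectrum is a nonempty finite set of reals. -/
def neumannGroundEnergy {d : ℕ} (Λ : Finset (Lattice d)) (W : Lattice d → ℝ) : ℝ :=
  sInf (spectrum ℝ (neumannLaplacian Λ + Matrix.diagonal fun i : Λ => W i.1))

/-! ### The displacement model -/

/-- The data of the model: the side lengths `M` of the tile `Λ = ∏ [1, M_i]`, the side lengths `b`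
of the box `B = ∏ [1, b_i]`, `1 ≤ b_i ≤ M_i`, and a single-site potential `q` supported in `B`. -/
structure Model (d : ℕ) where
  M : Fin d → ℕ
  b : Fin d → ℕ
  one_le_b : ∀ i, 1 ≤ b i
  b_le_M : ∀ i, b i ≤ M i
  q : Lattice d → ℝ
  q_supp : ∀ x : Lattice d, q x ≠ 0 → ∀ i, 1 ≤ x i ∧ x i ≤ b i

namespace Model

variable {d : ℕ} (D : Model d)

/-- The tile `Λ = ∏ [1, M_i]`. -/
def tile : Finset (Lattice d) := Finset.Icc (fun _ => 1) (fun i => (D.M i : ℤ))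

/-- The set `Δ = ∏ [0, M_i - b_i]` of admissible displacements. -/
def Disp : Set (Lattice d) := Set.Icc (fun _ => 0) (fun i => (D.M i : ℤ) - D.b i)

/-- The translate `q_a(n) = q(n - a)`. -/
def translate (a : Lattice d) : Lattice d → ℝ := fun n => D.q (n - a)

/-- `q` is reflection symmetric in each variable:
`q(…, x_i, …) = q(…, b_i - x_i + 1, …)` for all `x` and `i`. -/
def ReflectionSymmetric : Prop :=
  ∀ (x : Lattice d) (i : Fin d), D.q x = D.q (Function.update x i ((D.b i : ℤ) - x i + 1))

/-- `q` is sign-definite: `q ≥ 0` everywhere or `q ≤ 0` everywhere. -/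
def SignDefinite : Prop := (∀ x, 0 ≤ D.q x) ∨ (∀ x, D.q x ≤ 0)

/-- `E₀(a) = min σ(h^N_{0,Λ} + q_a)`. -/
def E₀ (a : Lattice d) : ℝ := neumannGroundEnergy D.tile (D.translate a)

/-- `Ẽ₀(a) = min σ(h^N_{0,Λ} - q_a)`. -/
def Etilde₀ (a : Lattice d) : ℝ := neumannGroundEnergy D.tile (-D.translate a)

/-- The configuration space `Ω = Δ^(ℤ^d)`. -/
abbrev Config : Type := Lattice d → D.Disp

/-- The position `kM + ω_k` of the displaced box in the tile with index `k`, where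
`kM = (k_i M_i)_i`. -/
def position (ω : D.Config) (k : Lattice d) : Lattice d :=
  (fun i => k i * D.M i) + (ω k).1

/-- The potential `V_ω = ∑_k q_{kM + ω_k}`; at each lattice point at most one term is nonzero, see
`support_subsingleton`. -/
def potential (ω : D.Config) (n : Lattice d) : ℝ :=
  ∑ᶠ k : Lattice d, D.translate (D.position ω k) n

theorem support_subsingleton (ω : D.Config) (n : Lattice d) :
    (Function.support fun k : Lattice d => D.translate (D.position ω k) n).Subsingleton := by
  have key : ∀ k : Lattice d, D.translate (D.position ω k) n ≠ 0 → ∀ i,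
      k i * D.M i + 1 ≤ n i ∧ n i ≤ k i * D.M i + D.M i := by
    intro k hk i
    have h := D.q_supp _ hk i
    have h0 := (ω k).2.1 i
    have h1 := (ω k).2.2 i
    simp only [position, Pi.sub_apply, Pi.add_apply] at h h0 h1
    constructor <;> linarith [h.1, h.2]
  intro k hk l hl
  ext i
  have hk := key k hk i
  have hl := key l hl i
  have hM : (0 : ℤ) ≤ D.M i := Int.natCast_nonneg _
  rcases lt_trichotomy (k i) (l i) with h | h | h
  · have : (k i + 1) * (D.M i : ℤ) ≤ l i * D.M i := mul_le_mul_of_nonneg_right h hM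
    linarith
  · exact h
  · have : (l i + 1) * (D.M i : ℤ) ≤ k i * D.M i := mul_le_mul_of_nonneg_right h hM
    linarith

theorem exists_potential_bound : ∃ C : ℝ, ∀ ω n, |D.potential ω n| ≤ C := by
  have hfin : (Function.support D.q).Finite :=
    (Set.finite_Icc (fun _ => (1 : ℤ)) (fun i => (D.b i : ℤ))).subset fun x hx =>
      ⟨fun i => (D.q_supp x hx i).1, fun i => (D.q_supp x hx i).2⟩
  refine ⟨∑ x ∈ hfin.toFinset, |D.q x|, fun ω n => ?_⟩
  have hq : ∀ x, |D.q x| ≤ ∑ x ∈ hfin.toFinset, |D.q x| := by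
    intro x
    by_cases hx : D.q x = 0
    · rw [hx, abs_zero]; exact Finset.sum_nonneg fun _ _ => abs_nonneg _
    · exact Finset.single_le_sum (f := fun x => |D.q x|) (fun _ _ => abs_nonneg _)
        (hfin.mem_toFinset.2 hx)
  by_cases hex : ∃ k, D.translate (D.position ω k) n ≠ 0
  · obtain ⟨k, hk⟩ := hex
    have : D.potential ω n = D.translate (D.position ω k) n :=
      finsum_eq_single _ k fun l hl => by
        by_contra hne
        exact hl (D.support_subsingleton ω n hne hk)
    rw [this]; exact hq _
  · push Not at hex
    have : D.potential ω n = 0 := by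
      unfold potential; simp [hex]
    rw [this, abs_zero]; exact Finset.sum_nonneg fun _ _ => abs_nonneg _

/-- The operator of multiplication by the bounded function `V_ω` on `ℓ²(ℤ^d)`. -/
def potentialOp (ω : D.Config) : Hilb d →L[ℂ] Hilb d :=
  lp.mapCLM 2 (K := |D.exists_potential_bound.choose|)
    (fun n => (D.potential ω n : ℂ) • ContinuousLinearMap.id ℂ ℂ) (abs_nonneg _) fun n => by
      rw [norm_smul, ContinuousLinearMap.norm_id, mul_one, Complex.norm_real, Real.norm_eq_abs]
      exact (D.exists_potential_bound.choose_spec ω n).trans (le_abs_self _)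

theorem potentialOp_apply (ω : D.Config) (u : Hilb d) (n : Lattice d) :
    D.potentialOp ω u n = D.potential ω n * u n := rfl

/-- The Schrödinger operator `h_ω = h₀ + V_ω`. -/
def hamiltonian (ω : D.Config) : Hilb d →L[ℂ] Hilb d :=
  freeLaplacian d + D.potentialOp ω

/-- The spectrum `σ(h_ω)`, as a set of real numbers (`h_ω` is self-adjoint, see
`isSelfAdjoint_hamiltonian`, so there is no other spectrum). -/
def spec (ω : D.Config) : Set ℝ := spectrum ℝ (D.hamiltonian ω)

theorem isSelfAdjoint_hamiltonian (ω : D.Config) : IsSelfAdjoint (D.hamiltonian ω) := by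
  have hshift : ∀ (v : Lattice d) (x y : Hilb d),
      inner ℂ (shift v x) y = inner ℂ x (shift (-v) y) := by
    intro v x y
    rw [lp.inner_eq_tsum, lp.inner_eq_tsum,
      ← (Equiv.addRight v).tsum_eq fun n => inner ℂ (x n) (shift (-v) y n)]
    refine tsum_congr fun n => ?_
    change inner ℂ (x (n + v)) (y n) = inner ℂ (x (n + v)) (y (n + v + -v))
    rw [add_neg_cancel_right]
  refine IsSelfAdjoint.add ?_ ?_
  · rw [ContinuousLinearMap.isSelfAdjoint_iff_isSymmetric]
    intro x y
    simp only [freeLaplacian, ContinuousLinearMap.coe_coe, neg_apply, sum_apply, add_apply,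
      LinearIsometry.coe_toContinuousLinearMap, inner_neg_left, inner_neg_right, sum_inner,
      inner_sum, inner_add_left, inner_add_right, hshift, neg_neg]
    congr 1
    exact Finset.sum_congr rfl fun _ _ => add_comm _ _
  · rw [ContinuousLinearMap.isSelfAdjoint_iff_isSymmetric]
    intro x y
    simp only [ContinuousLinearMap.coe_coe]
    rw [lp.inner_eq_tsum, lp.inner_eq_tsum]
    refine tsum_congr fun n => ?_
    rw [potentialOp_apply, potentialOp_apply]
    simp only [RCLike.inner_apply, map_mul, Complex.conj_ofReal]
    ring

/-- `ω` is spectrally minimizing: `min σ(h_ω) = E_min`, where `E_min = inf_{ω'} min σ(h_{ω'})`.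
The existence of all these minima and of the infimum is part of the assertion. -/
def IsSpectrallyMinimizing (ω : D.Config) : Prop :=
  (∀ ω' : D.Config, ∃ E, IsLeast (D.spec ω') E) ∧
    ∃ Emin : ℝ, IsGLB {E : ℝ | ∃ ω' : D.Config, IsLeast (D.spec ω') E} Emin ∧
      IsLeast (D.spec ω) Emin

/-- `ω` is spectrally maximizing: `max σ(h_ω) = E_max`, where `E_max = sup_{ω'} max σ(h_{ω'})`.
The existence of all these maxima and of the supremum is part of the assertion. -/
def IsSpectrallyMaximizing (ω : D.Config) : Prop :=
  (∀ ω' : D.Config, ∃ E, IsGreatest (D.spec ω') E) ∧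
    ∃ Emax : ℝ, IsLUB {E : ℝ | ∃ ω' : D.Config, IsGreatest (D.spec ω') E} Emax ∧
      IsGreatest (D.spec ω) Emax

/-- The configuration `ω*`: `(ω*_k)_i = 0` if `k_i` is even and `(ω*_k)_i = M_i - b_i` if `k_i` is
odd. -/
def omegaStar : D.Config := fun k =>
  ⟨fun i => if Even (k i) then 0 else (D.M i : ℤ) - D.b i, by
    have h : ∀ i, (D.b i : ℤ) ≤ D.M i := fun i => by exact_mod_cast D.b_le_M i
    constructor
    · intro i
      have := h i
      dsimp only
      split_ifs <;> omega
    · intro i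
      have := h i
      dsimp only
      split_ifs <;> omega⟩

end Model

end DiscreteDisplacement

end

/-!
Both parts rest on the Neumann problem on a single tile. Repeated reflection identifies functions on
the tile `Λ` with functions on `ℤ^d` that are invariant under the folding map `ℤ^d → Λ`
(`FoldInvariant`), and on such functions the Neumann Laplacian of `Λ` is just the free Laplacian
(`FoldInvariant.neumannOp_eq`). By Perron–Frobenius the tile has a positive Neumann ground state,
whose extension `ψ` solves the eigenvalue equation on all of `ℤ^d` (`exists_groundState`).

*Bubbles tend to the corners* (`E₀_zero_le`): `E₀(0) ≤ E₀(a)` for all `a ∈ Δ`. If the box can move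
both ways along `e_i`, use `ψ(· ± e_i)` as trial functions for the displacements `a ∓ e_i`. They
violate the Neumann equation only at the two faces of the tile orthogonal to `e_i`, and the two
excess energies add up to minus the sum of `(ψ(n) - ψ(m))²` over the edges from those faces into
the tile. If `E₀` is minimal at `a`, both excesses are nonnegative, hence both vanish, and
`a - e_i` is a minimizer too (`E₀_sub_single_le`). If the box touches the upper face, reflect it to the
lower face (`E₀_update_le`). Thus the minimizer with the least coordinate sum is `0`.

*Spectral consequences.* Cutting all edges between tiles only lowers the quadratic form, so
`h_ω ≥ E₀(0)` for every `ω` (`le_inner_hamiltonian`). By the reflection symmetry of `q` the potential of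
`ω*` is `q` composed with the folding map (`potential_omegaStar`); so for `a = 0` the function `ψ`
is a bounded positive solution of `h_{ω*} ψ = E₀(0) ψ`, and multiplying it by `r^|n|` with `r → 1`
gives a Weyl sequence (`mem_spec_of_pos_solution`). Hence `E₀(0)` is the minimum of the spectrum
of `h_{ω*}` and the infimum over all configurations. Conjugation by `(-1)^(n_1 + … + n_d)` turns
`h₀ + V_ω` into `-(h₀ - V_ω)`, which reduces the maximum to the minimum for `-q`.
-/

noncomputable section

namespace DiscreteDisplacement

/-! ### The least eigenvalue of a real symmetric matrix -/

section Matrix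

open Matrix

variable {ι : Type*} [Fintype ι] [DecidableEq ι]

theorem sInf_spectrum_mem [Nonempty ι] {A : Matrix ι ι ℝ} (hA : A.IsHermitian) :
    sInf (spectrum ℝ A) ∈ spectrum ℝ A := by
  rw [hA.spectrum_real_eq_range_eigenvalues]
  exact (Set.range_nonempty _).csInf_mem (Set.finite_range _)

theorem posSemidef_sub_sInf_spectrum {A : Matrix ι ι ℝ} (hA : A.IsHermitian) :
    (A - sInf (spectrum ℝ A) • (1 : Matrix ι ι ℝ)).PosSemidef := by
  rw [Matrix.posSemidef_iff_isHermitian_and_spectrum_nonneg]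
  refine ⟨hA.sub (by simp [Matrix.IsHermitian]), fun x hx => ?_⟩
  have hx' : x + sInf (spectrum ℝ A) ∈ spectrum ℝ A := by
    have := spectrum.add_mem_add_iff (R := ℝ) (r := x) (s := sInf (spectrum ℝ A))
      (a := A - sInf (spectrum ℝ A) • (1 : Matrix ι ι ℝ))
    rw [Algebra.algebraMap_eq_smul_one, add_comm (_ • _), sub_add_cancel] at this
    exact this.2 hx
  have hbdd : BddBelow (spectrum ℝ A) := by
    rw [hA.spectrum_real_eq_range_eigenvalues]
    exact (Set.finite_range _).bddBelow
  have := csInf_le hbdd hx'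
  simp only [Set.mem_ofPred_eq]
  linarith

theorem sInf_spectrum_mul_le {A : Matrix ι ι ℝ} (hA : A.IsHermitian) (v : ι → ℝ) :
    sInf (spectrum ℝ A) * (v ⬝ᵥ v) ≤ v ⬝ᵥ A *ᵥ v := by
  have h := (posSemidef_sub_sInf_spectrum hA).dotProduct_mulVec_nonneg v
  simp only [star_trivial, sub_mulVec, smul_mulVec, one_mulVec, dotProduct_sub, dotProduct_smul,
    smul_eq_mul] at h
  linarith

theorem mulVec_eq_of_le_sInf_spectrum {A : Matrix ι ι ℝ} (hA : A.IsHermitian) {v : ι → ℝ}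
    (hv : v ⬝ᵥ A *ᵥ v ≤ sInf (spectrum ℝ A) * (v ⬝ᵥ v)) :
    A *ᵥ v = sInf (spectrum ℝ A) • v := by
  have h := (posSemidef_sub_sInf_spectrum hA).dotProduct_mulVec_zero_iff v
  simp only [star_trivial, sub_mulVec, smul_mulVec, one_mulVec, dotProduct_sub, dotProduct_smul,
    smul_eq_mul] at h
  exact sub_eq_zero.1 (h.1 (by linarith [sInf_spectrum_mul_le hA v]))

/-- Perron–Frobenius: a real symmetric matrix with nonpositive off-diagonal entries whose nonzero
entries connect all indices has a strictly positive eigenvector for its least eigenvalue. -/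
theorem exists_pos_eigenvector [Nonempty ι] {A : Matrix ι ι ℝ} (hA : A.IsHermitian)
    (hoff : ∀ i j, i ≠ j → A i j ≤ 0)
    (hconn : ∀ S : Set ι, S.Nonempty → (∀ i ∈ S, ∀ j, A i j ≠ 0 → j ∈ S) → S = Set.univ) :
    ∃ v : ι → ℝ, (∀ i, 0 < v i) ∧ A *ᵥ v = sInf (spectrum ℝ A) • v := by
  obtain ⟨v, hv0, hv⟩ : ∃ v : ι → ℝ, v ≠ 0 ∧ A *ᵥ v = sInf (spectrum ℝ A) • v := by
    have h := sInf_spectrum_mem hA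
    rw [← Matrix.spectrum_toLin', ← Module.End.hasEigenvalue_iff_mem_spectrum] at h
    obtain ⟨v, hv⟩ := h.exists_hasEigenvector
    exact ⟨v, hv.2, by simpa using hv.apply_eq_smul⟩
  -- Passing to absolute values does not raise the quadratic form.
  have habs : A *ᵥ (fun i => |v i|) = sInf (spectrum ℝ A) • fun i => |v i| := by
    apply mulVec_eq_of_le_sInf_spectrum hA
    have h1 : (fun i => |v i|) ⬝ᵥ A *ᵥ (fun i => |v i|) ≤ v ⬝ᵥ A *ᵥ v := by
      simp only [dotProduct, mulVec, Finset.mul_sum]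
      refine Finset.sum_le_sum fun i _ => Finset.sum_le_sum fun j _ => ?_
      by_cases hij : i = j
      · subst hij
        rw [mul_left_comm, abs_mul_abs_self, mul_left_comm (v i)]
      · nlinarith [hoff i j hij, le_abs_self (v i * v j), abs_mul (v i) (v j)]
    have h2 : (fun i => |v i|) ⬝ᵥ (fun i => |v i|) = v ⬝ᵥ v := by
      simp [dotProduct]
    rw [h2]
    refine h1.trans (le_of_eq ?_)
    rw [hv, dotProduct_smul, smul_eq_mul]
  refine ⟨fun i => |v i|, fun i => ?_, habs⟩
  by_contra hi
  refine hv0 ?_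
  have hS := hconn {i | v i = 0} ⟨i, by simpa using hi⟩ ?_
  · funext i
    have hmem : i ∈ {i | v i = 0} := hS ▸ Set.mem_univ i
    exact hmem
  · intro i hi j hij
    have h := congrFun habs i
    have hi' : v i = 0 := hi
    simp only [mulVec, dotProduct, Pi.smul_apply, hi', abs_zero, smul_zero] at h
    have hterm := (Finset.sum_eq_zero_iff_of_nonpos fun k _ => ?_).1 h j (Finset.mem_univ j)
    · simpa [hij] using hterm
    · by_cases hik : i = k
      · subst hik; simp [hi']
      · exact mul_nonpos_of_nonpos_of_nonneg (hoff i k hik) (abs_nonneg _)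

end Matrix

/-! ### Nearest neighbours and the Neumann Laplacian of a finite set -/

section Neumann

open Matrix

variable {d : ℕ}

theorem normOne_neg (k : Lattice d) : normOne (-k) = normOne k := by simp [normOne]

theorem normOne_sub_comm (m n : Lattice d) : normOne (m - n) = normOne (n - m) := by
  rw [← normOne_neg, neg_sub]

/-- The set of the `2 d` nearest neighbours `n ± e_i` of `n`. -/
def nbrs (n : Lattice d) : Finset (Lattice d) :=
  (Finset.univ.image fun i : Fin d => n + Pi.single i 1) ∪
    Finset.univ.image fun i : Fin d => n - Pi.single i 1

theorem mem_nbrs {m n : Lattice d} : m ∈ nbrs n ↔ normOne (n - m) = 1 := by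
  rw [normOne_sub_comm, normOne_eq_one_iff]
  simp only [nbrs, Finset.mem_union, Finset.mem_image, Finset.mem_univ, true_and, ← exists_or]
  refine exists_congr fun i => or_congr ?_ ?_
  · rw [sub_eq_iff_eq_add', eq_comm]
  · exact ⟨fun h => by rw [← h]; abel, fun h => by rw [eq_add_of_sub_eq' h]; abel⟩

theorem sum_nbrs (n : Lattice d) (F : Lattice d → ℝ) :
    ∑ m ∈ nbrs n, F m = ∑ i, (F (n + Pi.single i 1) + F (n - Pi.single i 1)) := by
  have hinj : Function.Injective fun i : Fin d => (Pi.single i 1 : Lattice d) := by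
    intro i j hij
    by_contra hne
    simpa [hne] using congrFun hij i
  rw [nbrs, Finset.sum_union, Finset.sum_image, Finset.sum_image, Finset.sum_add_distrib]
  · exact fun i _ j _ h => hinj (sub_right_injective h)
  · exact fun i _ j _ h => hinj (add_right_injective n h)
  · rw [Finset.disjoint_left]
    rintro m hm hm'
    obtain ⟨i, -, rfl⟩ := Finset.mem_image.1 hm
    obtain ⟨j, -, hj⟩ := Finset.mem_image.1 hm'
    have := congrFun hj i
    by_cases hij : i = j
    · subst hij
      simp at this
      omega
    · simp [hij] at this

theorem neumannLaplacian_isHermitian (Λ : Finset (Lattice d)) (W : Lattice d → ℝ) :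
    (neumannLaplacian Λ + Matrix.diagonal fun i : Λ => W i.1).IsHermitian := by
  refine Matrix.IsHermitian.add (Matrix.IsHermitian.sub ?_ ?_) ?_
  · ext i j
    simp [normOne_sub_comm i.1 j.1]
  · exact Matrix.isHermitian_diagonal _
  · exact Matrix.isHermitian_diagonal _

/-- The Neumann Laplacian replaces the value at a missing neighbour by the value at the point
itself. -/
theorem neumannLaplacian_mulVec (Λ : Finset (Lattice d)) (g : Lattice d → ℝ) (n : Λ) :
    (neumannLaplacian Λ *ᵥ fun i : Λ => g i) n =
      -∑ i, ((if n.1 + Pi.single i 1 ∈ Λ then g (n.1 + Pi.single i 1) else g n) +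
        (if n.1 - Pi.single i 1 ∈ Λ then g (n.1 - Pi.single i 1) else g n)) := by
  rw [← sum_nbrs n.1 fun m => if m ∈ Λ then g m else g n]
  have hcount : (edgeCount Λ n.1 : ℝ) = ∑ m ∈ nbrs n.1, if m ∈ Λ then 0 else 1 := by
    have hset : {j : Lattice d | j ∉ Λ ∧ normOne (n.1 - j) = 1} =
        ((nbrs n.1).filter fun m => m ∉ Λ : Finset (Lattice d)) := by
      ext m
      simp [mem_nbrs, and_comm]
    rw [edgeCount, hset, Set.ncard_coe_finset, Finset.card_filter, Nat.cast_sum]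
    refine Finset.sum_congr rfl fun m _ => ?_
    split_ifs <;> simp_all
  have hadj : ((Matrix.of fun i j : Λ => if normOne (i.1 - j.1) = 1 then (-1 : ℝ) else 0) *ᵥ
      fun i : Λ => g i) n = -∑ m ∈ nbrs n.1, if m ∈ Λ then g m else 0 := by
    rw [← Finset.sum_filter, Finset.filter_mem_eq_inter, Finset.inter_comm,
      ← Finset.filter_mem_eq_inter, Finset.sum_filter, ← Finset.sum_coe_sort Λ, mulVec, dotProduct,
      ← Finset.sum_neg_distrib]
    refine Finset.sum_congr rfl fun m _ => ?_
    simp [mem_nbrs, neg_ite]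
  rw [neumannLaplacian, sub_mulVec, Pi.sub_apply, hadj, mulVec_diagonal, hcount, Finset.sum_mul,
    neg_sub_left, ← Finset.sum_add_distrib]
  congr 1
  refine Finset.sum_congr rfl fun m _ => ?_
  split_ifs <;> simp

/-- The operator `h^N_{0,Λ} + W`, acting on functions on the whole lattice (whose values off `Λ` are
disregarded). -/
def neumannOp (Λ : Finset (Lattice d)) (W g : Lattice d → ℝ) (n : Lattice d) : ℝ :=
  -∑ i, ((if n + Pi.single i 1 ∈ Λ then g (n + Pi.single i 1) else g n) +
    (if n - Pi.single i 1 ∈ Λ then g (n - Pi.single i 1) else g n)) + W n * g n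

theorem mulVec_eq_neumannOp (Λ : Finset (Lattice d)) (W g : Lattice d → ℝ) (n : Λ) :
    ((neumannLaplacian Λ + Matrix.diagonal fun i : Λ => W i.1) *ᵥ fun i : Λ => g i) n =
      neumannOp Λ W g n := by
  rw [add_mulVec, Pi.add_apply, neumannLaplacian_mulVec, mulVec_diagonal, neumannOp]

theorem neumannGroundEnergy_mul_le (Λ : Finset (Lattice d)) (W g : Lattice d → ℝ) :
    neumannGroundEnergy Λ W * ∑ n ∈ Λ, g n ^ 2 ≤ ∑ n ∈ Λ, g n * neumannOp Λ W g n := by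
  have h := sInf_spectrum_mul_le (neumannLaplacian_isHermitian Λ W) fun i : Λ => g i
  rw [← Finset.sum_coe_sort Λ, ← Finset.sum_coe_sort Λ]
  simp only [dotProduct, mulVec_eq_neumannOp, ← pow_two] at h
  exact h

/-- Discrete integration by parts: up to the constant `2 d`, the quadratic form of the Neumann
Laplacian is the Dirichlet form over the edges inside `Λ`, hence at most the sum over all edges that
start in `Λ`. -/
theorem sum_mul_neumannOp_le (Λ : Finset (Lattice d)) (W g : Lattice d → ℝ) :
    ∑ n ∈ Λ, g n * neumannOp Λ W g n ≤
      ∑ n ∈ Λ, (∑ i, (g (n + Pi.single i 1) - g n) ^ 2 + (W n - 2 * d) * g n ^ 2) := by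
  have hshift : ∀ i : Fin d, ∑ n ∈ Λ, (if n - Pi.single i 1 ∈ Λ then
      g n * (g n - g (n - Pi.single i 1)) else 0) = ∑ n ∈ Λ, (if n + Pi.single i 1 ∈ Λ then
      g (n + Pi.single i 1) * (g (n + Pi.single i 1) - g n) else 0) := by
    intro i
    rw [← Finset.sum_filter, ← Finset.sum_filter]
    refine Finset.sum_nbij' (· - Pi.single i 1) (· + Pi.single i 1) ?_ ?_ ?_ ?_ ?_ <;>
      simp +contextual
  have hform : ∑ n ∈ Λ, g n * neumannOp Λ W g n =
      ∑ i, ∑ n ∈ Λ, ((if n + Pi.single i 1 ∈ Λ then g n * (g n - g (n + Pi.single i 1)) else 0) +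
        (if n - Pi.single i 1 ∈ Λ then g n * (g n - g (n - Pi.single i 1)) else 0)) +
      ∑ n ∈ Λ, (W n - 2 * d) * g n ^ 2 := by
    rw [Finset.sum_comm, ← Finset.sum_add_distrib]
    refine Finset.sum_congr rfl fun n _ => ?_
    have hd : (d : ℝ) = ∑ _i : Fin d, 1 := by simp
    rw [neumannOp, hd, mul_add, mul_neg, Finset.mul_sum, Finset.mul_sum, sub_mul, Finset.sum_mul]
    have : ∀ i : Fin d, g n * ((if n + Pi.single i 1 ∈ Λ then g (n + Pi.single i 1) else g n) +
        (if n - Pi.single i 1 ∈ Λ then g (n - Pi.single i 1) else g n)) = 2 * 1 * g n ^ 2 -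
        ((if n + Pi.single i 1 ∈ Λ then g n * (g n - g (n + Pi.single i 1)) else 0) +
        (if n - Pi.single i 1 ∈ Λ then g n * (g n - g (n - Pi.single i 1)) else 0)) := by
      intro i
      split_ifs <;> ring
    simp only [this, Finset.sum_sub_distrib]
    ring
  have hcomm : ∑ n ∈ Λ, ∑ i, (g (n + Pi.single i 1) - g n) ^ 2 =
      ∑ i, ∑ n ∈ Λ, (g (n + Pi.single i 1) - g n) ^ 2 := Finset.sum_comm
  rw [hform, Finset.sum_add_distrib (s := Λ), hcomm]
  refine add_le_add_left (Finset.sum_le_sum fun i _ => ?_) _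
  rw [Finset.sum_add_distrib, hshift, ← Finset.sum_add_distrib]
  refine Finset.sum_le_sum fun n _ => ?_
  split_ifs <;> nlinarith [sq_nonneg (g (n + Pi.single i 1) - g n)]

end Neumann

/-! ### Folding the lattice onto a tile -/

/-- The folding map of `ℤ` onto `[1, M]`: the intervals `[k M + 1, k M + M]` are translated to
`[1, M]` and, for odd `k`, also reflected. -/
def fold (M : ℕ) (n : ℤ) : ℤ :=
  if Even ((n - 1) / M) then n - (n - 1) / M * M else ((n - 1) / M + 1) * M + 1 - n

section Fold

variable {M : ℕ}

theorem fold_mul_add {k t : ℤ} (h1 : 1 ≤ t) (h2 : t ≤ M) :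
    fold M (k * M + t) = if Even k then t else M + 1 - t := by
  have hk : (k * M + t - 1) / (M : ℤ) = k := by
    rw [show k * (M : ℤ) + t - 1 = t - 1 + k * M by ring, Int.add_mul_ediv_right _ _ (by omega),
      Int.ediv_eq_zero_of_lt (by omega) (by omega), zero_add]
  rw [fold, hk]
  split_ifs <;> ring

theorem exists_eq_mul_add (hM : 0 < M) (n : ℤ) : ∃ k t : ℤ, 1 ≤ t ∧ t ≤ M ∧ n = k * M + t := by
  have hM' : (0 : ℤ) < M := by exact_mod_cast hM
  refine ⟨(n - 1) / M, (n - 1) % M + 1, ?_, ?_, ?_⟩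
  · linarith [Int.emod_nonneg (n - 1) hM'.ne']
  · linarith [Int.emod_lt_of_pos (n - 1) hM']
  · linarith [Int.ediv_mul_add_emod (n - 1) M]

theorem fold_of_mem {n : ℤ} (h1 : 1 ≤ n) (h2 : n ≤ M) : fold M n = n := by
  simpa using fold_mul_add (k := 0) h1 h2

theorem fold_mem (hM : 0 < M) (n : ℤ) : 1 ≤ fold M n ∧ fold M n ≤ M := by
  obtain ⟨k, t, h1, h2, rfl⟩ := exists_eq_mul_add hM n
  rw [fold_mul_add h1 h2]
  split_ifs <;> omega

theorem fold_add_two_mul (hM : 0 < M) (n j : ℤ) : fold M (n + 2 * j * M) = fold M n := by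
  obtain ⟨k, t, h1, h2, rfl⟩ := exists_eq_mul_add hM n
  rw [show k * (M : ℤ) + t + 2 * j * M = (k + 2 * j) * M + t by ring, fold_mul_add h1 h2,
    fold_mul_add h1 h2]
  simp [Int.even_add]

theorem fold_one_sub (hM : 0 < M) (n : ℤ) : fold M (1 - n) = fold M n := by
  obtain ⟨k, t, h1, h2, rfl⟩ := exists_eq_mul_add hM n
  rw [show 1 - (k * (M : ℤ) + t) = (-k - 1) * M + (M + 1 - t) by ring,
    fold_mul_add (by omega) (by omega), fold_mul_add h1 h2]
  by_cases hk : Even k <;> simp [hk]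

theorem fold_two_mul_add_one_sub (hM : 0 < M) (n : ℤ) : fold M (2 * M + 1 - n) = fold M n := by
  rw [show 2 * (M : ℤ) + 1 - n = 1 - n + 2 * 1 * M by ring, fold_add_two_mul hM, fold_one_sub hM]

theorem fold_reflect (hM : 0 < M) (n : ℤ) : fold M (M + 1 - n) = M + 1 - fold M n := by
  obtain ⟨k, t, h1, h2, rfl⟩ := exists_eq_mul_add hM n
  rw [show (M : ℤ) + 1 - (k * (M : ℤ) + t) = (-k) * M + (M + 1 - t) by ring,
    fold_mul_add (by omega) (by omega), fold_mul_add h1 h2]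
  by_cases hk : Even k <;> simp [hk]

/-- Folding respects nearest neighbours, possibly exchanging left and right. -/
theorem fold_neighbors (hM : 0 < M) (n : ℤ) :
    (fold M (n + 1) = fold M (fold M n + 1) ∧ fold M (n - 1) = fold M (fold M n - 1)) ∨
      (fold M (n + 1) = fold M (fold M n - 1) ∧ fold M (n - 1) = fold M (fold M n + 1)) := by
  obtain ⟨k, t, h1, h2, rfl⟩ := exists_eq_mul_add hM n
  rw [fold_mul_add h1 h2]
  rcases Int.even_or_odd' k with ⟨j, rfl | rfl⟩
  · left
    simp only [even_two, Even.mul_right, if_true]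
    constructor
    · rw [← fold_add_two_mul hM (t + 1) j]; ring_nf
    · rw [← fold_add_two_mul hM (t - 1) j]; ring_nf
  · right
    have : ¬ Even (2 * j + 1) := by simp
    simp only [this, if_false]
    constructor
    · rw [← fold_one_sub hM (M + 1 - t - 1),
        ← fold_add_two_mul hM (1 - (M + 1 - t - 1)) (j + 1)]
      ring_nf
    · rw [← fold_one_sub hM (M + 1 - t + 1),
        ← fold_add_two_mul hM (1 - (M + 1 - t + 1)) (j + 1)]
      ring_nf

end Fold

namespace Model

variable {d : ℕ} (D : Model d)

theorem M_pos (i : Fin d) : 0 < D.M i := (D.one_le_b i).trans (D.b_le_M i)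

theorem mem_tile {n : Lattice d} : n ∈ D.tile ↔ ∀ i, 1 ≤ n i ∧ n i ≤ D.M i := by
  rw [tile, Finset.mem_Icc, Pi.le_def, Pi.le_def, ← forall_and]

theorem mem_Disp {a : Lattice d} : a ∈ D.Disp ↔ ∀ i, 0 ≤ a i ∧ a i ≤ (D.M i : ℤ) - D.b i := by
  rw [Disp, Set.mem_Icc, Pi.le_def, Pi.le_def, ← forall_and]

/-- The coordinatewise folding map of `ℤ^d` onto the tile. -/
def foldTile (n : Lattice d) : Lattice d := fun i => fold (D.M i) (n i)

theorem foldTile_mem (n : Lattice d) : D.foldTile n ∈ D.tile :=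
  D.mem_tile.2 fun i => fold_mem (D.M_pos i) (n i)

theorem foldTile_of_mem {n : Lattice d} (hn : n ∈ D.tile) : D.foldTile n = n :=
  funext fun i => fold_of_mem (D.mem_tile.1 hn i).1 (D.mem_tile.1 hn i).2

theorem tile_nonempty : D.tile.Nonempty := ⟨_, D.foldTile_mem 0⟩

theorem foldTile_add_single (n : Lattice d) (i : Fin d) (s : ℤ) :
    D.foldTile (n + Pi.single i s) =
      Function.update (D.foldTile n) i (fold (D.M i) (n i + s)) := by
  ext j
  by_cases hj : j = i
  · subst hj; simp [foldTile]
  · simp [foldTile, hj]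

/-- The functions on `ℤ^d` that arise from functions on the tile by repeated reflection. -/
def FoldInvariant (ψ : Lattice d → ℝ) : Prop := ∀ n, ψ (D.foldTile n) = ψ n

variable {D} {ψ : Lattice d → ℝ}

theorem FoldInvariant.apply_add_single_congr (hψ : D.FoldInvariant ψ) {n : Lattice d} {i : Fin d}
    {s t : ℤ} (h : fold (D.M i) (n i + s) = fold (D.M i) (n i + t)) :
    ψ (n + Pi.single i s) = ψ (n + Pi.single i t) := by
  have hf : D.foldTile (n + Pi.single i s) = D.foldTile (n + Pi.single i t) := by
    rw [foldTile_add_single, foldTile_add_single, h]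
  exact (hψ _).symm.trans ((congrArg ψ hf).trans (hψ _))

/-- Reflection across the upper face: one step out is the same as no step, and two steps out are the
same as one step in. -/
theorem FoldInvariant.upper_face (hψ : D.FoldInvariant ψ) {n : Lattice d} {i : Fin d}
    (hn : n i = D.M i) (s : ℤ) :
    ψ (n + Pi.single i (1 + s)) = ψ (n + Pi.single i (-s)) := by
  refine hψ.apply_add_single_congr ?_
  rw [← fold_two_mul_add_one_sub (D.M_pos i), hn]
  ring_nf

/-- Reflection across the lower face. -/
theorem FoldInvariant.lower_face (hψ : D.FoldInvariant ψ) {n : Lattice d} {i : Fin d}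
    (hn : n i = 1) (s : ℤ) :
    ψ (n + Pi.single i (-(1 + s))) = ψ (n + Pi.single i s) := by
  refine hψ.apply_add_single_congr ?_
  rw [← fold_one_sub (D.M_pos i), hn]
  ring_nf

theorem FoldInvariant.sum_neighbors (hψ : D.FoldInvariant ψ) (n : Lattice d) :
    ∑ i, (ψ (n + Pi.single i 1) + ψ (n - Pi.single i 1)) =
      ∑ i, (ψ (D.foldTile n + Pi.single i 1) + ψ (D.foldTile n - Pi.single i 1)) := by
  refine Finset.sum_congr rfl fun i _ => ?_
  have hf : ∀ m : Lattice d, ∀ s : ℤ, ψ (m + Pi.single i s) =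
      ψ (Function.update (D.foldTile m) i (fold (D.M i) (m i + s))) := fun m s => by
    rw [← hψ, foldTile_add_single]
  have hff : D.foldTile (D.foldTile n) = D.foldTile n := D.foldTile_of_mem (D.foldTile_mem n)
  simp only [sub_eq_add_neg, ← Pi.single_neg]
  simp only [hf, hff]
  rcases fold_neighbors (D.M_pos i) (n i) with ⟨h1, h2⟩ | ⟨h1, h2⟩
  · simp only [foldTile, ← sub_eq_add_neg, h1, h2]
  · simp only [foldTile, ← sub_eq_add_neg, h1, h2]
    exact add_comm _ _

variable (D)

theorem add_single_notMem_tile {n : Lattice d} (hn : n ∈ D.tile) (i : Fin d) :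
    n + Pi.single i 1 ∉ D.tile ↔ n i = D.M i := by
  rw [mem_tile] at hn ⊢
  constructor
  · intro h
    by_contra hne
    refine h fun j => ?_
    have := hn j
    by_cases hj : j = i
    · subst hj
      simp only [Pi.add_apply, Pi.single_eq_same]
      omega
    · simpa [hj] using this
  · intro h h'
    have := h' i
    simp only [Pi.add_apply, Pi.single_eq_same] at this
    omega

theorem sub_single_notMem_tile {n : Lattice d} (hn : n ∈ D.tile) (i : Fin d) :
    n - Pi.single i 1 ∉ D.tile ↔ n i = 1 := by
  rw [mem_tile] at hn ⊢
  constructor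
  · intro h
    by_contra hne
    refine h fun j => ?_
    have := hn j
    by_cases hj : j = i
    · subst hj
      simp only [Pi.sub_apply, Pi.single_eq_same]
      omega
    · simpa [hj] using this
  · intro h h'
    have := h' i
    simp only [Pi.sub_apply, Pi.single_eq_same] at this
    omega

variable {D}

/-- For fold-invariant functions the Neumann Laplacian of the tile is the free one. -/
theorem FoldInvariant.neumannOp_eq (hψ : D.FoldInvariant ψ) (W : Lattice d → ℝ) {n : Lattice d}
    (hn : n ∈ D.tile) : neumannOp D.tile W ψ n =
      -∑ i, (ψ (n + Pi.single i 1) + ψ (n - Pi.single i 1)) + W n * ψ n := by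
  rw [neumannOp]
  congr 2
  refine Finset.sum_congr rfl fun i _ => ?_
  congr 1
  · split_ifs with h
    · rfl
    · simpa using (hψ.upper_face ((D.add_single_notMem_tile hn i).1 h) 0).symm
  · split_ifs with h
    · rfl
    · simpa [← sub_eq_add_neg, Pi.single_neg] using
        (hψ.lower_face ((D.sub_single_notMem_tile hn i).1 h) 0).symm

variable (D)

/-- The tile is connected through nearest neighbours. -/
theorem tile_connected {S : Set (Lattice d)} {n : Lattice d} (hn : n ∈ S) (hnt : n ∈ D.tile)
    (hS : ∀ x ∈ S, x ∈ D.tile → ∀ y ∈ D.tile, normOne (x - y) = 1 → y ∈ S) {m : Lattice d}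
    (hm : m ∈ D.tile) : m ∈ S := by
  induction hk : (normOne (m - n)).toNat using Nat.strong_induction_on generalizing n with
  | _ k ih =>
    subst hk
    by_cases hmn : m = n
    · exact hmn ▸ hn
    obtain ⟨i, hi⟩ := Function.ne_iff.1 hmn
    -- One step from `n` towards `m` in a coordinate in which they differ.
    obtain ⟨s, hs, hstep⟩ : ∃ s : ℤ, (s = 1 ∨ s = -1) ∧
        ((n i < m i ∧ s = 1) ∨ (m i < n i ∧ s = -1)) := by
      rcases lt_or_gt_of_ne hi with h | h
      · exact ⟨-1, by simp, by simp [h]⟩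
      · exact ⟨1, by simp, by simp [h]⟩
    have hx : n + Pi.single i s ∈ D.tile := by
      rw [mem_tile] at hm hnt ⊢
      intro j
      have h1 := hm j
      have h2 := hnt j
      by_cases hj : j = i
      · subst hj
        simp only [Pi.add_apply, Pi.single_eq_same]
        omega
      · simpa [hj] using h2
    have hnorm : normOne (n - (n + Pi.single i s)) = 1 := by
      rw [normOne_sub_comm, normOne_eq_one_iff]
      refine ⟨i, ?_⟩
      rcases hs with rfl | rfl
      · left; simp
      · right; simp [Pi.single_neg]
    have hlt : normOne (m - (n + Pi.single i s)) < normOne (m - n) := by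
      refine Finset.sum_lt_sum (fun j _ => ?_) ⟨i, Finset.mem_univ i, ?_⟩
      · by_cases hj : j = i
        · subst hj
          simp only [Pi.sub_apply, Pi.add_apply, Pi.single_eq_same, abs_eq_max_neg]
          omega
        · simp [hj]
      · simp only [Pi.sub_apply, Pi.add_apply, Pi.single_eq_same, abs_eq_max_neg]
        omega
    have hnn : 0 ≤ normOne (m - (n + Pi.single i s)) :=
      Finset.sum_nonneg fun _ _ => abs_nonneg _
    exact ih _ (by omega) (hS n hn hnt _ hx hnorm) hx rfl

/-- The positive Neumann ground state of the tile, extended to the lattice by reflection; the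
extension solves the eigenvalue equation on all of `ℤ^d`. -/
theorem exists_groundState (W : Lattice d → ℝ) : ∃ ψ : Lattice d → ℝ, (∀ n, 0 < ψ n) ∧
    D.FoldInvariant ψ ∧ ∀ n, -∑ i, (ψ (n + Pi.single i 1) + ψ (n - Pi.single i 1)) +
      W (D.foldTile n) * ψ n = neumannGroundEnergy D.tile W * ψ n := by
  have : Nonempty D.tile := D.tile_nonempty.to_subtype
  have hoffdiag : ∀ i j : D.tile, i ≠ j →
      (neumannLaplacian D.tile + Matrix.diagonal fun i : D.tile => W i.1) i j =
        if normOne (i.1 - j.1) = 1 then -1 else 0 := fun i j hij => by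
    simp [neumannLaplacian, hij]
  obtain ⟨v, hv, hvE⟩ := exists_pos_eigenvector (neumannLaplacian_isHermitian D.tile W)
    (fun i j hij => by rw [hoffdiag i j hij]; split_ifs <;> norm_num) (by
      rintro S ⟨⟨n, hnt⟩, hn⟩ hS
      refine Set.eq_univ_of_forall fun m => ?_
      have := D.tile_connected (S := Subtype.val '' S) ⟨_, hn, rfl⟩ hnt ?_ m.2
      · simpa using this
      rintro _ ⟨x, hx, rfl⟩ - y hy hxy
      refine ⟨⟨y, hy⟩, hS x hx _ ?_, rfl⟩
      rw [hoffdiag _ _ fun h => by subst h; simp [normOne] at hxy]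
      simp [hxy])
  set ψ : Lattice d → ℝ := fun n => v ⟨D.foldTile n, D.foldTile_mem n⟩ with hψdef
  have hψ : D.FoldInvariant ψ := fun n => by
    simp only [hψdef, D.foldTile_of_mem (D.foldTile_mem n)]
  have hvψ : v = fun i : D.tile => ψ i := by
    funext i
    simp only [hψdef, D.foldTile_of_mem i.2]
  refine ⟨ψ, fun n => hv _, hψ, fun n => ?_⟩
  have h := congrFun hvE ⟨D.foldTile n, D.foldTile_mem n⟩
  rw [hvψ, mulVec_eq_neumannOp, hψ.neumannOp_eq W (D.foldTile_mem n)] at h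
  rw [hψ.sum_neighbors n, ← hψ n]
  exact h

end Model

namespace Model

variable {d : ℕ} {D : Model d} {ψ : Lattice d → ℝ}

/-! ### Bubbles tend to the corners -/

theorem FoldInvariant.apply_add_single (hψ : D.FoldInvariant ψ) {n : Lattice d} {i : Fin d}
    (hn : n i = D.M i) : ψ (n + Pi.single i 1) = ψ n := by
  simpa using hψ.upper_face hn 0

theorem FoldInvariant.apply_sub_single (hψ : D.FoldInvariant ψ) {n : Lattice d} {i : Fin d}
    (hn : n i = 1) : ψ (n - Pi.single i 1) = ψ n := by
  simpa [Pi.single_neg, ← sub_eq_add_neg] using hψ.lower_face hn 0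

theorem FoldInvariant.apply_add_single_add_single (hψ : D.FoldInvariant ψ) {n : Lattice d}
    {i : Fin d} (hn : n i = D.M i) :
    ψ (n + Pi.single i 1 + Pi.single i 1) = ψ (n - Pi.single i 1) := by
  rw [add_assoc, ← Pi.single_add, hψ.upper_face hn 1, Pi.single_neg, ← sub_eq_add_neg]

theorem FoldInvariant.apply_sub_single_sub_single (hψ : D.FoldInvariant ψ) {n : Lattice d}
    {i : Fin d} (hn : n i = 1) :
    ψ (n - Pi.single i 1 - Pi.single i 1) = ψ (n + Pi.single i 1) := by
  rw [← hψ.lower_face hn 1, neg_add, Pi.single_add, Pi.single_neg, sub_eq_add_neg, sub_eq_add_neg,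
    add_assoc]

/-- The translate `ψ (· + e_i)` of a fold-invariant solution fails to be a Neumann eigenfunction on
the tile only at the two faces orthogonal to `e_i`. -/
theorem FoldInvariant.neumannOp_shift_up (hψ : D.FoldInvariant ψ) {W W' : Lattice d → ℝ} {E : ℝ}
    (hE : ∀ n, -∑ i, (ψ (n + Pi.single i 1) + ψ (n - Pi.single i 1)) + W (D.foldTile n) * ψ n =
      E * ψ n) (i : Fin d) {n : Lattice d} (hn : n ∈ D.tile)
    (hW : W' n = W (D.foldTile (n + Pi.single i 1))) :
    neumannOp D.tile W' (fun m => ψ (m + Pi.single i 1)) n =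
      E * ψ (n + Pi.single i 1) + ((if n i = D.M i then ψ (n - Pi.single i 1) - ψ n else 0) +
        (if n i = 1 then ψ n - ψ (n + Pi.single i 1) else 0)) := by
  set δ : ℝ := (if n i = D.M i then ψ (n - Pi.single i 1) - ψ n else 0) +
        (if n i = 1 then ψ n - ψ (n + Pi.single i 1) else 0) with hδ
  -- The face terms belong to the summand of direction `i`.
  have hδsum : δ = ∑ j, if j = i then δ else 0 := by simp
  rw [← hE, ← hW, neumannOp, add_right_comm]
  congr 1
  rw [hδsum, ← sub_eq_iff_eq_add, sub_eq_add_neg, ← neg_add, neg_inj, ← Finset.sum_add_distrib]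
  refine Finset.sum_congr rfl fun j _ => ?_
  by_cases hj : j = i
  · subst hj
    have hup := D.add_single_notMem_tile hn j
    have hdown := D.sub_single_notMem_tile hn j
    simp only [if_true, hδ, sub_add_cancel, add_sub_cancel_right, ← hup, ← hdown]
    by_cases h1 : n + Pi.single j 1 ∈ D.tile <;> by_cases h2 : n - Pi.single j 1 ∈ D.tile <;>
      simp only [h1, h2, not_true_eq_false, not_false_eq_true, if_true, if_false]
    · ring
    · ring
    · rw [hψ.apply_add_single (hup.1 h1), hψ.apply_add_single_add_single (hup.1 h1)]; ring
    · rw [hψ.apply_add_single (hup.1 h1), hψ.apply_add_single_add_single (hup.1 h1)]; ring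
  · simp only [hj, if_false, add_zero]
    congr 1
    · split_ifs with h
      · rw [add_right_comm]
      · refine (hψ.apply_add_single ?_).symm
        simpa [hj] using (D.add_single_notMem_tile hn j).1 h
    · split_ifs with h
      · rw [sub_add_eq_add_sub]
      · refine (hψ.apply_sub_single ?_).symm
        simpa [hj] using (D.sub_single_notMem_tile hn j).1 h

/-- The mirror image of `neumannOp_shift_up`, for the translate `ψ (· - e_i)`. -/
theorem FoldInvariant.neumannOp_shift_down (hψ : D.FoldInvariant ψ) {W W' : Lattice d → ℝ} {E : ℝ}
    (hE : ∀ n, -∑ i, (ψ (n + Pi.single i 1) + ψ (n - Pi.single i 1)) + W (D.foldTile n) * ψ n =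
      E * ψ n) (i : Fin d) {n : Lattice d} (hn : n ∈ D.tile)
    (hW : W' n = W (D.foldTile (n - Pi.single i 1))) :
    neumannOp D.tile W' (fun m => ψ (m - Pi.single i 1)) n =
      E * ψ (n - Pi.single i 1) + ((if n i = 1 then ψ (n + Pi.single i 1) - ψ n else 0) +
        (if n i = D.M i then ψ n - ψ (n - Pi.single i 1) else 0)) := by
  set δ : ℝ := (if n i = 1 then ψ (n + Pi.single i 1) - ψ n else 0) +
        (if n i = D.M i then ψ n - ψ (n - Pi.single i 1) else 0) with hδ
  -- The face terms belong to the summand of direction `i`.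
  have hδsum : δ = ∑ j, if j = i then δ else 0 := by simp
  rw [← hE, ← hW, neumannOp, add_right_comm]
  congr 1
  rw [hδsum, ← sub_eq_iff_eq_add, sub_eq_add_neg, ← neg_add, neg_inj, ← Finset.sum_add_distrib]
  refine Finset.sum_congr rfl fun j _ => ?_
  by_cases hj : j = i
  · subst hj
    have hup := D.add_single_notMem_tile hn j
    have hdown := D.sub_single_notMem_tile hn j
    simp only [if_true, hδ, sub_add_cancel, add_sub_cancel_right, ← hup, ← hdown]
    by_cases h1 : n + Pi.single j 1 ∈ D.tile <;> by_cases h2 : n - Pi.single j 1 ∈ D.tile <;>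
      simp only [h1, h2, not_true_eq_false, not_false_eq_true, if_true, if_false]
    · ring
    · rw [hψ.apply_sub_single (hdown.1 h2), hψ.apply_sub_single_sub_single (hdown.1 h2)]; ring
    · ring
    · rw [hψ.apply_sub_single (hdown.1 h2), hψ.apply_sub_single_sub_single (hdown.1 h2)]; ring
  · simp only [hj, if_false, add_zero]
    congr 1
    · split_ifs with h
      · rw [sub_add_eq_add_sub]
      · refine (hψ.apply_add_single ?_).symm
        simpa [hj] using (D.add_single_notMem_tile hn j).1 h
    · split_ifs with h
      · rw [sub_right_comm]
      · refine (hψ.apply_sub_single ?_).symm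
        simpa [hj] using (D.sub_single_notMem_tile hn j).1 h

theorem translate_eq_zero (D : Model d) {a n : Lattice d} (i : Fin d)
    (h : n i - a i < 1 ∨ D.b i < n i - a i) : D.translate a n = 0 := by
  by_contra hne
  have := D.q_supp _ hne i
  simp only [Pi.sub_apply] at this
  omega

/-- If the box can move both ways along `e_i` and the upward move does not lower the Neumann ground
state energy, then the downward move does not raise it. -/
theorem E₀_sub_single_le (D : Model d) {a : Lattice d} {i : Fin d} (h0 : 0 < a i)
    (h1 : a i < (D.M i : ℤ) - D.b i)
    (hup : D.E₀ a ≤ D.E₀ (a + Pi.single i 1)) :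
    D.E₀ (a - Pi.single i 1) ≤ D.E₀ a := by
  obtain ⟨ψ, hpos, hψ, hE⟩ := D.exists_groundState (D.translate a)
  change ∀ n, _ = D.E₀ a * ψ n at hE
  have hW : ∀ n ∈ D.tile, D.translate (a - Pi.single i 1) n =
      D.translate a (D.foldTile (n + Pi.single i 1)) := by
    intro n hn
    by_cases h : n + Pi.single i 1 ∈ D.tile
    · rw [D.foldTile_of_mem h, translate, translate]
      congr 1
      abel
    · have hni := (D.add_single_notMem_tile hn i).1 h
      have hfold : D.foldTile (n + Pi.single i 1) i = D.M i := by
        have := fold_two_mul_add_one_sub (D.M_pos i) (D.M i)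
        rw [fold_of_mem (by have := D.M_pos i; omega) le_rfl] at this
        rw [foldTile, Pi.add_apply, Pi.single_eq_same, hni]
        convert this using 2
        ring
      rw [D.translate_eq_zero i, D.translate_eq_zero i]
      · rw [hfold]; omega
      · simp only [Pi.sub_apply, Pi.single_eq_same]; omega
  have hW' : ∀ n ∈ D.tile, D.translate (a + Pi.single i 1) n =
      D.translate a (D.foldTile (n - Pi.single i 1)) := by
    intro n hn
    by_cases h : n - Pi.single i 1 ∈ D.tile
    · rw [D.foldTile_of_mem h, translate, translate]
      congr 1
      abel
    · have hni := (D.sub_single_notMem_tile hn i).1 h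
      have hfold : D.foldTile (n - Pi.single i 1) i = 1 := by
        have := fold_one_sub (D.M_pos i) 1
        rw [fold_of_mem le_rfl (by have := D.M_pos i; omega)] at this
        rw [foldTile, Pi.sub_apply, Pi.single_eq_same, hni, this]
      rw [D.translate_eq_zero i, D.translate_eq_zero i]
      · rw [hfold]; omega
      · simp only [Pi.add_apply, Pi.single_eq_same]; omega
  have hlow := neumannGroundEnergy_mul_le D.tile (D.translate (a - Pi.single i 1))
    fun m => ψ (m + Pi.single i 1)
  have hupp := neumannGroundEnergy_mul_le D.tile (D.translate (a + Pi.single i 1))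
    fun m => ψ (m - Pi.single i 1)
  replace hlow := hlow.trans_eq <| Finset.sum_congr rfl fun n hn =>
    congrArg (ψ (n + Pi.single i 1) * ·) (hψ.neumannOp_shift_up hE i hn (hW n hn))
  replace hupp := hupp.trans_eq <| Finset.sum_congr rfl fun n hn =>
    congrArg (ψ (n - Pi.single i 1) * ·) (hψ.neumannOp_shift_down hE i hn (hW' n hn))
  change D.E₀ (a - Pi.single i 1) * _ ≤ _ at hlow
  change D.E₀ (a + Pi.single i 1) * _ ≤ _ at hupp
  simp only [mul_add, Finset.sum_add_distrib, mul_left_comm _ (D.E₀ a), ← Finset.mul_sum,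
    ← pow_two] at hlow hupp
  simp only [← Finset.sum_add_distrib] at hlow hupp
  -- The two excess energies add up to minus a sum of squares over the faces.
  have hsum : ∑ n ∈ D.tile, (ψ (n + Pi.single i 1) *
        (if n i = D.M i then ψ (n - Pi.single i 1) - ψ n else 0) +
        ψ (n + Pi.single i 1) * (if n i = 1 then ψ n - ψ (n + Pi.single i 1) else 0)) +
      ∑ n ∈ D.tile, (ψ (n - Pi.single i 1) *
        (if n i = 1 then ψ (n + Pi.single i 1) - ψ n else 0) +
        ψ (n - Pi.single i 1) * (if n i = D.M i then ψ n - ψ (n - Pi.single i 1) else 0)) ≤ 0 := by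
    rw [← Finset.sum_add_distrib]
    refine Finset.sum_nonpos fun n _ => ?_
    have e1 : n i = D.M i → ψ (n + Pi.single i 1) = ψ n := hψ.apply_add_single
    have e2 : n i = 1 → ψ (n - Pi.single i 1) = ψ n := hψ.apply_sub_single
    split_ifs with h h'
    · rw [e1 h, e2 h']; simp
    · rw [e1 h]; nlinarith [sq_nonneg (ψ (n - Pi.single i 1) - ψ n)]
    · rw [e2 ‹_›]; nlinarith [sq_nonneg (ψ (n + Pi.single i 1) - ψ n)]
    · simp
  have hnorm_up : 0 ≤ ∑ n ∈ D.tile, ψ (n - Pi.single i 1) ^ 2 :=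
    Finset.sum_nonneg fun _ _ => sq_nonneg _
  have hnorm : 0 < ∑ n ∈ D.tile, ψ (n + Pi.single i 1) ^ 2 :=
    Finset.sum_pos (fun n _ => pow_pos (hpos _) 2) D.tile_nonempty
  refine le_of_mul_le_mul_right ?_ hnorm
  nlinarith [mul_le_mul_of_nonneg_right hup hnorm_up]

/-- Reflecting the box inside the tile does not raise the Neumann ground state energy. -/
theorem E₀_update_le {D : Model d} (hH1 : D.ReflectionSymmetric) (a : Lattice d) (i : Fin d) :
    D.E₀ (Function.update a i ((D.M i : ℤ) - D.b i - a i)) ≤ D.E₀ a := by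
  obtain ⟨ψ, hpos, hψ, hE⟩ := D.exists_groundState (D.translate a)
  change ∀ n, _ = D.E₀ a * ψ n at hE
  set R : Lattice d → Lattice d := fun n => Function.update n i ((D.M i : ℤ) + 1 - n i) with hR
  have hRmem : ∀ n ∈ D.tile, R n ∈ D.tile := by
    intro n hn
    rw [mem_tile] at hn ⊢
    intro j
    have := hn j
    by_cases hj : j = i
    · subst hj
      simp only [hR, Function.update_self]
      omega
    · simpa [hR, hj] using this
  have hg : D.FoldInvariant fun n => ψ (R n) := by
    intro n
    have : R (D.foldTile n) = D.foldTile (R n) := by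
      ext j
      by_cases hj : j = i
      · subst hj
        simp [hR, foldTile, fold_reflect (D.M_pos j)]
      · simp [hR, foldTile, hj]
    simp only [this, hψ (R n)]
  have hop : ∀ n ∈ D.tile, neumannOp D.tile
      (D.translate (Function.update a i ((D.M i : ℤ) - D.b i - a i))) (fun n => ψ (R n)) n =
      D.E₀ a * ψ (R n) := by
    intro n hn
    rw [hg.neumannOp_eq _ hn, ← hE, D.foldTile_of_mem (hRmem n hn)]
    congr 2
    · refine Finset.sum_congr rfl fun j _ => ?_
      by_cases hj : j = i
      · subst hj
        rw [add_comm]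
        congr 2
        · ext l
          by_cases hl : l = j
          · subst hl; simp [hR]; ring
          · simp [hR, hl]
        · ext l
          by_cases hl : l = j
          · subst hl; simp [hR]; ring
          · simp [hR, hl]
      · congr 2
        · ext l
          by_cases hl : l = i
          · subst hl; simp [hR, Ne.symm hj]
          · simp [hR, hl]
        · ext l
          by_cases hl : l = i
          · subst hl; simp [hR, Ne.symm hj]
          · simp [hR, hl]
    · rw [translate, translate, hH1 _ i]
      congr 1
      ext l
      by_cases hl : l = i
      · subst hl; simp [hR]; ring
      · simp [hR, hl]
  have h := neumannGroundEnergy_mul_le D.tile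
    (D.translate (Function.update a i ((D.M i : ℤ) - D.b i - a i))) fun n => ψ (R n)
  replace h := h.trans_eq <| Finset.sum_congr rfl fun n hn => congrArg (ψ (R n) * ·) (hop n hn)
  simp only [mul_left_comm _ (D.E₀ a), ← Finset.mul_sum, ← pow_two] at h
  exact le_of_mul_le_mul_right h
    (Finset.sum_pos (fun n _ => pow_pos (hpos _) 2) D.tile_nonempty)

/-- Bubbles tend to the corners: the Neumann ground state energy is minimal at the corner position
`a = 0`. -/
theorem E₀_zero_le {D : Model d} (hH1 : D.ReflectionSymmetric) {a : Lattice d} (ha : a ∈ D.Disp) :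
    D.E₀ 0 ≤ D.E₀ a := by
  have hfin : D.Disp.Finite := Set.finite_Icc _ _
  obtain ⟨m, hm, hmin⟩ := Set.exists_min_image D.Disp D.E₀ hfin ⟨a, ha⟩
  -- Among the minimizers, one with the least coordinate sum is the corner `0`.
  obtain ⟨c, ⟨hc, hcm⟩, hcmin⟩ := Set.exists_min_image {c ∈ D.Disp | D.E₀ c ≤ D.E₀ m}
    (fun c => ∑ i, c i) (hfin.subset fun _ h => h.1) ⟨m, hm, le_rfl⟩
  suffices c = 0 from this ▸ hcm.trans (hmin a ha)
  have hci := D.mem_Disp.1 hc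
  ext i
  by_contra hne
  have hpos : 0 < c i := lt_of_le_of_ne (hci i).1 (Ne.symm hne)
  have hmove : ∀ t : ℤ, 0 ≤ t → t ≤ (D.M i : ℤ) - D.b i → Function.update c i t ∈ D.Disp := by
    intro t h0 h1
    rw [mem_Disp]
    intro j
    by_cases hj : j = i
    · subst hj; simpa using ⟨h0, h1⟩
    · simpa [hj] using hci j
  have hlower : ∀ t : ℤ, 0 ≤ t → t < c i → D.E₀ (Function.update c i t) ≤ D.E₀ c → False := by
    intro t h0 h1 hle
    have h := hcmin _ ⟨hmove t h0 (h1.le.trans (hci i).2), hle.trans hcm⟩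
    refine absurd h (not_le.2 (Finset.sum_lt_sum (fun j _ => ?_) ⟨i, Finset.mem_univ i, ?_⟩))
    · by_cases hj : j = i
      · subst hj; simpa using h1.le
      · simp [hj]
    · simpa using h1
  rcases (hci i).2.lt_or_eq with hlt | heq
  · refine hlower (c i - 1) (by omega) (by omega) ?_
    have hdown : Function.update c i (c i - 1) = c - Pi.single i 1 := by
      ext j
      by_cases hj : j = i
      · subst hj; simp
      · simp [hj]
    have hup : Function.update c i (c i + 1) = c + Pi.single i 1 := by
      ext j
      by_cases hj : j = i
      · subst hj; simp
      · simp [hj]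
    rw [hdown]
    exact D.E₀_sub_single_le hpos hlt
      (hup ▸ hcm.trans (hmin _ (hmove (c i + 1) (by omega) (by omega))))
  · refine hlower 0 le_rfl hpos ?_
    have := E₀_update_le hH1 c i
    rwa [← heq, sub_self] at this

end Model

/-! ### Spectral criteria for bounded self-adjoint operators -/

section Spectrum

variable {H : Type*} [NormedAddCommGroup H] [InnerProductSpace ℂ H]

theorem le_of_mem_spectrum_of_le_inner [CompleteSpace H] {T : H →L[ℂ] H} (hT : IsSelfAdjoint T)
    {E : ℝ} (hE : ∀ u : H, E * ‖u‖ ^ 2 ≤ (inner ℂ u (T u)).re) {x : ℝ}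
    (hx : (x : ℂ) ∈ spectrum ℂ T) : E ≤ x := by
  have hle : algebraMap ℝ (H →L[ℂ] H) E ≤ T := by
    rw [ContinuousLinearMap.le_def, ContinuousLinearMap.isPositive_def']
    refine ⟨hT.sub (IsSelfAdjoint.algebraMap _ (IsSelfAdjoint.all E)), fun u => ?_⟩
    have h := hE u
    rw [ContinuousLinearMap.reApplyInnerSelf_apply, sub_apply, inner_sub_left,
      map_sub, sub_nonneg, inner_re_symm (T u)]
    refine le_trans (le_of_eq ?_) h
    rw [Algebra.algebraMap_eq_smul_one, smul_apply,
      one_apply_eq_self, ← Complex.coe_smul, inner_smul_left, Complex.conj_ofReal,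
      RCLike.re_eq_complex_re, Complex.re_ofReal_mul, inner_self_eq_norm_sq_to_K]
    norm_cast
  exact (algebraMap_le_iff_le_spectrum hT).1 hle x
    ((spectrum.algebraMap_mem_iff ℂ).1 (by simpa using hx))

/-- Weyl's criterion: approximate eigenvectors for `z` put `z` into the spectrum. -/
theorem mem_spectrum_of_approx {T : H →L[ℂ] H} {z : ℂ}
    (h : ∀ ε : ℝ, 0 < ε → ∃ u : H, u ≠ 0 ∧ ‖T u - z • u‖ ≤ ε * ‖u‖) : z ∈ spectrum ℂ T := by
  rw [spectrum.mem_iff]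
  rintro ⟨S, hS⟩
  obtain ⟨u, hu0, hu⟩ := h (1 / (2 * (‖(↑S⁻¹ : H →L[ℂ] H)‖ + 1))) (by positivity)
  have hinv : u = (↑S⁻¹ : H →L[ℂ] H) (z • u - T u) := by
    have h1 : (↑S⁻¹ * ↑S : H →L[ℂ] H) u = u := by rw [Units.inv_mul]; rfl
    rw [hS, mul_apply_eq_comp, sub_apply,
      Algebra.algebraMap_eq_smul_one, smul_apply,
      one_apply_eq_self] at h1
    exact h1.symm
  have h2 : ‖u‖ ≤ ‖(↑S⁻¹ : H →L[ℂ] H)‖ * (1 / (2 * (‖(↑S⁻¹ : H →L[ℂ] H)‖ + 1)) * ‖u‖) := by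
    calc ‖u‖ = ‖(↑S⁻¹ : H →L[ℂ] H) (z • u - T u)‖ := by rw [← hinv]
      _ ≤ ‖(↑S⁻¹ : H →L[ℂ] H)‖ * ‖z • u - T u‖ := ContinuousLinearMap.le_opNorm _ _
      _ ≤ _ := by
        rw [norm_sub_rev]
        exact mul_le_mul_of_nonneg_left hu (norm_nonneg _)
  have hu' : 0 < ‖u‖ := norm_pos_iff.2 hu0
  set c := ‖(↑S⁻¹ : H →L[ℂ] H)‖ with hc
  have hc0 : 0 ≤ c := norm_nonneg _
  have h3 : c * (1 / (2 * (c + 1)) * ‖u‖) = c / (2 * (c + 1)) * ‖u‖ := by ring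
  have h4 : c / (2 * (c + 1)) ≤ 1 / 2 := by
    rw [div_le_div_iff₀ (by positivity) (by norm_num)]
    linarith
  nlinarith

end Spectrum

/-! ### The Dirichlet form on `ℓ²(ℤ^d)` -/

section Lattice

variable {d : ℕ}

theorem hasSum_norm_sq (u : Hilb d) : HasSum (fun n => ‖u n‖ ^ 2) (‖u‖ ^ 2) := by
  have h := lp.hasSum_norm (p := 2) (by norm_num) u
  simpa using h

theorem norm_le_of_forall_le {u v : Hilb d} {c : ℝ} (hc : 0 ≤ c) (h : ∀ n, ‖u n‖ ≤ c * ‖v n‖) :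
    ‖u‖ ≤ c * ‖v‖ := by
  have h2 : ‖u‖ ^ 2 ≤ (c * ‖v‖) ^ 2 := by
    rw [mul_pow]
    refine hasSum_le (fun n => ?_) (hasSum_norm_sq u) ((hasSum_norm_sq v).mul_left (c ^ 2))
    rw [← mul_pow]
    exact pow_le_pow_left₀ (norm_nonneg _) (h n) 2
  exact (pow_le_pow_iff_left₀ (norm_nonneg _) (by positivity) two_ne_zero).1 h2

theorem freeLaplacian_apply_eq_sum (u : Hilb d) (n : Lattice d) :
    freeLaplacian d u n = -∑ i, (u (n + Pi.single i 1) + u (n - Pi.single i 1)) := by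
  simp only [sub_eq_add_neg]
  unfold freeLaplacian
  rw [neg_apply, sum_apply, lp.coeFn_neg, Pi.neg_apply, lp.coeFn_sum, Finset.sum_apply]
  rfl

/-- Up to the constant `2 d`, the quadratic form of the discrete Laplacian is the Dirichlet form. -/
theorem hasSum_freeLaplacian (u : Hilb d) :
    HasSum (fun n => ∑ i, ‖u (n + Pi.single i 1) - u n‖ ^ 2 - 2 * d * ‖u n‖ ^ 2)
      (inner ℂ u (freeLaplacian d u)).re := by
  have hsub : ∀ i : Fin d, HasSum (fun n => ‖u (n + Pi.single i 1) - u n‖ ^ 2)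
      (‖shift (Pi.single i 1) u - u‖ ^ 2) := fun i => hasSum_norm_sq (shift (Pi.single i 1) u - u)
  have h := (hasSum_sum fun i (_ : i ∈ Finset.univ) => hsub i).sub
    ((hasSum_norm_sq u).mul_left (2 * d : ℝ))
  suffices hval : ∑ i : Fin d, ‖shift (Pi.single i 1) u - u‖ ^ 2 - 2 * d * ‖u‖ ^ 2 =
      (inner ℂ u (freeLaplacian d u)).re from hval ▸ h
  have hadj : ∀ i : Fin d, inner ℂ u (shift (-Pi.single i 1) u) =
      inner ℂ (shift (Pi.single i 1) u) u := by
    intro i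
    rw [lp.inner_eq_tsum, lp.inner_eq_tsum,
      ← (Equiv.addRight (Pi.single i 1)).tsum_eq
        fun n => inner ℂ (u n) (shift (-Pi.single i 1) u n)]
    refine tsum_congr fun n => ?_
    change inner ℂ (u (n + Pi.single i 1)) (u (n + Pi.single i 1 + -Pi.single i 1)) =
      inner ℂ (u (n + Pi.single i 1)) (u n)
    rw [add_neg_cancel_right]
  have hi : ∀ i : Fin d, ‖shift (Pi.single i 1) u - u‖ ^ 2 = 2 * ‖u‖ ^ 2 -
      ((inner ℂ u (shift (Pi.single i 1) u)).re + (inner ℂ u (shift (-Pi.single i 1) u)).re) := by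
    intro i
    have h1 := norm_sub_sq (𝕜 := ℂ) (shift (Pi.single i 1) u) u
    rw [LinearIsometry.norm_map, RCLike.re_eq_complex_re] at h1
    have h2 := inner_re_symm (𝕜 := ℂ) (shift (Pi.single i 1) u) u
    simp only [RCLike.re_eq_complex_re] at h2
    rw [hadj, ← h2, h1]
    ring
  simp only [hi, freeLaplacian, neg_apply, sum_apply, add_apply, inner_neg_right, inner_sum,
    inner_add_right, LinearIsometry.coe_toContinuousLinearMap, Complex.neg_re, Complex.re_sum,
    Complex.add_re, Finset.sum_sub_distrib, Finset.sum_const, Finset.card_univ, Fintype.card_fin,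
    nsmul_eq_mul]
  ring

end Lattice

/-! ### Neumann bracketing -/

namespace Model

variable {d : ℕ} (D : Model d)

theorem mem_spec_iff {ω : D.Config} {x : ℝ} :
    x ∈ D.spec ω ↔ (x : ℂ) ∈ spectrum ℂ (D.hamiltonian ω) := by
  rw [spec, spectrum.mem_iff, spectrum.mem_iff]
  have : algebraMap ℝ (Hilb d →L[ℂ] Hilb d) x = algebraMap ℂ (Hilb d →L[ℂ] Hilb d) x := by
    rw [Algebra.algebraMap_eq_smul_one, Algebra.algebraMap_eq_smul_one]
    rfl
  rw [this]

theorem exists_isLeast_spec (ω : D.Config) : ∃ E, IsLeast (D.spec ω) E := by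
  have hnt : Nontrivial (Hilb d) := by
    refine ⟨⟨lp.single 2 0 1, 0, fun h => ?_⟩⟩
    have := congrArg (fun u : Hilb d => u 0) h
    simp at this
  have hne : (D.spec ω).Nonempty := by
    obtain ⟨z, hz⟩ := spectrum.nonempty (D.hamiltonian ω)
    refine ⟨z.re, D.mem_spec_iff.2 ?_⟩
    rwa [← (D.isSelfAdjoint_hamiltonian ω).mem_spectrum_eq_re hz]
  have hcpt : IsCompact (D.spec ω) := by
    have : D.spec ω = Complex.ofReal ⁻¹' spectrum ℂ (D.hamiltonian ω) :=
      Set.ext fun x => D.mem_spec_iff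
    rw [this]
    exact Complex.isometry_ofReal.isClosedEmbedding.isCompact_preimage (spectrum.isCompact _)
  exact hcpt.exists_isLeast hne

/-- The lower-left corner `k M` of the tile with index `k`. -/
def corner (k : Lattice d) : Lattice d := fun i => k i * D.M i

/-- The index of the tile that contains `n`. -/
def tileIndex (n : Lattice d) : Lattice d := fun i => (n i - 1) / D.M i

theorem tileIndex_eq_iff {n k : Lattice d} : D.tileIndex n = k ↔ n - D.corner k ∈ D.tile := by
  rw [mem_tile, funext_iff]
  refine forall_congr' fun i => ?_
  have hM : (0 : ℤ) < D.M i := by exact_mod_cast D.M_pos i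
  rw [tileIndex, Int.ediv_eq_iff_of_pos hM]
  simp only [Pi.sub_apply, corner]
  constructor <;> rintro ⟨h1, h2⟩ <;> constructor <;> linarith

theorem potential_corner_add (ω : D.Config) (k : Lattice d) {t : Lattice d} (ht : t ∈ D.tile) :
    D.potential ω (D.corner k + t) = D.translate (ω k).1 t := by
  have hk : D.translate (D.position ω k) (D.corner k + t) = D.translate (ω k).1 t := by
    rw [translate, translate, position]
    congr 1
    ext i
    simp only [corner, Pi.add_apply, Pi.sub_apply]
    ring
  rw [potential, ← hk]
  refine finsum_eq_single _ k fun l hl => ?_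
  by_contra hne
  refine hl ?_
  have hkt : D.tileIndex (D.corner k + t) = k := D.tileIndex_eq_iff.2 (by simpa using ht)
  rw [← hkt, eq_comm, tileIndex_eq_iff, mem_tile]
  intro i
  have h := D.q_supp _ hne i
  have h0 := D.mem_Disp.1 (ω l).2 i
  simp only [position, corner, Pi.sub_apply, Pi.add_apply] at h ⊢
  constructor <;> linarith [h.1, h.2]

/-- Neumann bracketing on a single tile. -/
theorem sum_tile_nonneg {E : ℝ} (hE : ∀ a ∈ D.Disp, E ≤ D.E₀ a) (ω : D.Config) (u : Hilb d)
    (k : Lattice d) : 0 ≤ ∑ t ∈ D.tile, (∑ i, ‖u (D.corner k + t + Pi.single i 1) -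
      u (D.corner k + t)‖ ^ 2 + (D.potential ω (D.corner k + t) - 2 * d - E) *
        ‖u (D.corner k + t)‖ ^ 2) := by
  have hreal : ∀ g : Lattice d → ℝ, 0 ≤ ∑ t ∈ D.tile, (∑ i, (g (t + Pi.single i 1) - g t) ^ 2 +
      (D.translate (ω k).1 t - 2 * d - E) * g t ^ 2) := by
    intro g
    have h1 := neumannGroundEnergy_mul_le D.tile (D.translate (ω k).1) g
    have h2 := sum_mul_neumannOp_le D.tile (D.translate (ω k).1) g
    have h3 : E * ∑ t ∈ D.tile, g t ^ 2 ≤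
        neumannGroundEnergy D.tile (D.translate (ω k).1) * ∑ t ∈ D.tile, g t ^ 2 :=
      mul_le_mul_of_nonneg_right (hE _ (ω k).2) (Finset.sum_nonneg fun _ _ => sq_nonneg _)
    have h4 := sub_nonneg.2 (h3.trans (h1.trans h2))
    rw [Finset.mul_sum, ← Finset.sum_sub_distrib] at h4
    refine h4.trans_eq (Finset.sum_congr rfl fun t _ => ?_)
    ring
  refine (add_nonneg (hreal fun t => (u (D.corner k + t)).re)
    (hreal fun t => (u (D.corner k + t)).im)).trans_eq ?_
  rw [← Finset.sum_add_distrib]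
  refine Finset.sum_congr rfl fun t ht => ?_
  rw [D.potential_corner_add ω k ht, Complex.sq_norm, Complex.normSq_apply]
  have : ∀ i : Fin d, ‖u (D.corner k + t + Pi.single i 1) - u (D.corner k + t)‖ ^ 2 =
      ((u (D.corner k + (t + Pi.single i 1))).re - (u (D.corner k + t)).re) ^ 2 +
      ((u (D.corner k + (t + Pi.single i 1))).im - (u (D.corner k + t)).im) ^ 2 := by
    intro i
    rw [Complex.sq_norm, Complex.normSq_apply, Complex.sub_re, Complex.sub_im, add_assoc]
    ring
  simp only [this, Finset.sum_add_distrib]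
  ring

theorem nonneg_of_hasSum_of_sum_tile_nonneg {G : Lattice d → ℝ} {c : ℝ} (hG : HasSum G c)
    (h : ∀ k, 0 ≤ ∑ t ∈ D.tile, G (D.corner k + t)) : 0 ≤ c := by
  refine (hG.tsum_fiberwise D.tileIndex).nonneg fun k => ?_
  have hfib : D.tileIndex ⁻¹' {k} =
      (D.tile.map (addLeftEmbedding (D.corner k)) : Set (Lattice d)) := by
    ext n
    rw [Set.mem_preimage, Set.mem_singleton_iff, tileIndex_eq_iff, Finset.mem_coe, Finset.mem_map]
    constructor
    · intro h
      exact ⟨_, h, by simp⟩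
    · rintro ⟨t, ht, rfl⟩
      simpa using ht
  rw [hfib, Finset.tsum_subtype', Finset.sum_map]
  exact h k

/-- Neumann bracketing: a common lower bound of the tile energies bounds every `h_ω` from below. -/
theorem le_inner_hamiltonian {E : ℝ} (hE : ∀ a ∈ D.Disp, E ≤ D.E₀ a) (ω : D.Config) (u : Hilb d) :
    E * ‖u‖ ^ 2 ≤ (inner ℂ u (D.hamiltonian ω u)).re := by
  have hV : HasSum (fun n => D.potential ω n * ‖u n‖ ^ 2) (inner ℂ u (D.potentialOp ω u)).re := by
    have h := Complex.hasSum_re (lp.hasSum_inner u (D.potentialOp ω u))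
    convert h using 2 with n
    rw [potentialOp_apply, ← Complex.real_smul, inner_smul_right_eq_smul, Complex.smul_re,
      smul_eq_mul, ← RCLike.re_eq_complex_re, inner_self_eq_norm_sq]
  have hG := ((hasSum_freeLaplacian u).add hV).sub ((hasSum_norm_sq u).mul_left E)
  rw [← Complex.add_re, ← inner_add_right] at hG
  change HasSum _ ((inner ℂ u (D.hamiltonian ω u)).re - _) at hG
  refine sub_nonneg.1 (D.nonneg_of_hasSum_of_sum_tile_nonneg hG fun k => ?_)
  refine (D.sum_tile_nonneg hE ω u k).trans_eq (Finset.sum_congr rfl fun t _ => ?_)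
  ring

end Model

/-! ### Exponential cut-offs on the lattice -/

section Decay

variable {d : ℕ}

/-- The exponentially decaying function `r ^ |n|` of the `1`-norm of `n`. -/
def decay (r : ℝ) (n : Lattice d) : ℝ := ∏ i, r ^ (n i).natAbs

theorem decay_pos {r : ℝ} (hr : 0 < r) (n : Lattice d) : 0 < decay r n :=
  Finset.prod_pos fun _ _ => pow_pos hr _

theorem summable_decay {r : ℝ} (h0 : 0 < r) (h1 : r < 1) :
    Summable fun n : Lattice d => decay r n := by
  have hint : Summable fun k : ℤ => r ^ k.natAbs := by
    rw [summable_int_iff_summable_nat_and_neg]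
    simpa using summable_geometric_of_lt_one h0.le h1
  refine summable_of_sum_le (c := ∏ _i : Fin d, ∑' k : ℤ, r ^ k.natAbs)
    (fun n => (decay_pos h0 n).le) fun s => ?_
  calc ∑ n ∈ s, decay r n
      ≤ ∑ n ∈ Fintype.piFinset fun i => s.image fun n => n i, decay r n := by
        refine Finset.sum_le_sum_of_subset_of_nonneg (fun n hn => ?_)
          fun n _ _ => (decay_pos h0 n).le
        rw [Fintype.mem_piFinset]
        exact fun i => Finset.mem_image_of_mem (fun n : Lattice d => n i) hn
    _ = ∏ i, ∑ k ∈ s.image fun n => n i, r ^ k.natAbs :=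
        (Finset.prod_univ_sum (fun i => s.image fun n => n i) fun _ k => r ^ k.natAbs).symm
    _ ≤ ∏ _i : Fin d, ∑' k : ℤ, r ^ k.natAbs :=
        Finset.prod_le_prod (fun i _ => Finset.sum_nonneg fun k _ => by positivity)
          fun i _ => hint.sum_le_tsum _ fun k _ => by positivity

theorem abs_decay_sub_le {δ : ℝ} (hδ : 0 < δ) (n : Lattice d) (i : Fin d) {s : ℤ}
    (hs : s = 1 ∨ s = -1) :
    |decay (1 + δ)⁻¹ (n + Pi.single i s) - decay (1 + δ)⁻¹ n| ≤ δ * decay (1 + δ)⁻¹ n := by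
  set r : ℝ := (1 + δ)⁻¹ with hr
  have hr0 : 0 < r := by positivity
  have hr1 : r * (1 + δ) = 1 := inv_mul_cancel₀ (by positivity)
  have hone : ∀ k : ℤ, |r ^ (k + s).natAbs - r ^ k.natAbs| ≤ δ * r ^ k.natAbs := by
    intro k
    have hcase : (k + s).natAbs = k.natAbs + 1 ∨ k.natAbs = (k + s).natAbs + 1 := by omega
    rw [abs_le]
    rcases hcase with h | h <;> rw [h, pow_succ]
    · have := pow_pos hr0 k.natAbs
      have hle : r ≤ 1 := inv_le_one_of_one_le₀ (by linarith)
      have hge : 1 - r ≤ δ := by nlinarith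
      constructor <;> nlinarith
    · have := pow_pos hr0 (k + s).natAbs
      have h3 : r ^ (k + s).natAbs = r ^ (k + s).natAbs * r * (1 + δ) := by
        rw [mul_assoc, hr1, mul_one]
      have := mul_pos this hr0
      constructor <;> nlinarith
  have hsplit : ∀ m : Lattice d, decay r m =
      r ^ (m i).natAbs * ∏ j ∈ Finset.univ.erase i, r ^ (m j).natAbs := fun m =>
    (Finset.mul_prod_erase _ _ (Finset.mem_univ i)).symm
  have hrest : ∏ j ∈ Finset.univ.erase i, r ^ ((n + Pi.single i s : Lattice d) j).natAbs =
      ∏ j ∈ Finset.univ.erase i, r ^ (n j).natAbs :=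
    Finset.prod_congr rfl fun j hj => by simp [Finset.ne_of_mem_erase hj]
  have hnn : 0 ≤ ∏ j ∈ Finset.univ.erase i, r ^ (n j).natAbs :=
    Finset.prod_nonneg fun _ _ => by positivity
  rw [hsplit, hsplit, hrest, ← sub_mul, abs_mul, abs_of_nonneg hnn, ← mul_assoc, Pi.add_apply,
    Pi.single_eq_same]
  exact mul_le_mul_of_nonneg_right (hone (n i)) hnn

end Decay

namespace Model

variable {d : ℕ} {D : Model d}

theorem hamiltonian_apply (D : Model d) (ω : D.Config) (u : Hilb d) (n : Lattice d) :
    D.hamiltonian ω u n =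
      -∑ i, (u (n + Pi.single i 1) + u (n - Pi.single i 1)) + D.potential ω n * u n := by
  rw [← freeLaplacian_apply_eq_sum, ← potentialOp_apply]
  rfl

/-- A bounded positive solution of `h_ω ψ = E ψ`, not necessarily square summable, puts `E` into the
spectrum: cutting it off exponentially yields approximate eigenvectors. -/
theorem mem_spec_of_pos_solution {ω : D.Config} {E C : ℝ} {ψ : Lattice d → ℝ}
    (hpos : ∀ n, 0 < ψ n) (hC : ∀ n, ψ n ≤ C)
    (hE : ∀ n, -∑ i, (ψ (n + Pi.single i 1) + ψ (n - Pi.single i 1)) + D.potential ω n * ψ n =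
      E * ψ n) : E ∈ D.spec ω := by
  obtain ⟨K, hK⟩ := D.exists_potential_bound
  have hK0 : 0 ≤ K := (abs_nonneg _).trans (hK ω 0)
  rw [mem_spec_iff]
  refine mem_spectrum_of_approx fun ε hε => ?_
  set δ : ℝ := ε / (K + |E| + 1) with hδdef
  have hδ : 0 < δ := by positivity
  set r : ℝ := (1 + δ)⁻¹ with hr
  have hr0 : 0 < r := by positivity
  have hr1 : r < 1 := inv_lt_one_of_one_lt₀ (by linarith)
  have hmem : Memℓp (fun n : Lattice d => ((decay r n * ψ n : ℝ) : ℂ)) 2 := by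
    refine (memℓp_gen_iff (p := 2) (by norm_num)).2 ?_
    have hsum := (summable_decay (d := d) (r := r ^ 2) (by positivity)
      (pow_lt_one₀ hr0.le hr1 two_ne_zero)).mul_right (C ^ 2)
    refine Summable.of_nonneg_of_le (fun n => by positivity) (fun n => ?_) hsum
    have hsq : decay (r ^ 2) n = decay r n ^ 2 := by
      rw [decay, decay, ← Finset.prod_pow]
      exact Finset.prod_congr rfl fun i _ => by rw [← pow_mul, ← pow_mul, mul_comm]
    rw [hsq, ← mul_pow, Complex.norm_real, Real.norm_eq_abs, ENNReal.toReal_ofNat,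
      Real.rpow_ofNat, sq_abs]
    have := decay_pos hr0 n
    exact pow_le_pow_left₀ (mul_pos this (hpos n)).le
      (mul_le_mul_of_nonneg_left (hC n) this.le) 2
  set u : Hilb d := ⟨_, hmem⟩ with hu
  have huapp : ∀ n, u n = ((decay r n * ψ n : ℝ) : ℂ) := fun n => rfl
  refine ⟨u, fun h0 => ?_, norm_le_of_forall_le hε.le fun n => ?_⟩
  · have h1 : u 0 = 0 := by rw [h0]; rfl
    rw [huapp, Complex.ofReal_eq_zero] at h1
    exact (mul_pos (decay_pos hr0 0) (hpos 0)).ne' h1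
  -- Only the differences of the cut-off across edges survive in `(h_ω - E) u`.
  have hval : (D.hamiltonian ω u - (E : ℂ) • u) n =
      ((-∑ i, ((decay r (n + Pi.single i 1) - decay r n) * ψ (n + Pi.single i 1) +
        (decay r (n - Pi.single i 1) - decay r n) * ψ (n - Pi.single i 1)) : ℝ) : ℂ) := by
    have hreal : -∑ i, ((decay r (n + Pi.single i 1) - decay r n) * ψ (n + Pi.single i 1) +
        (decay r (n - Pi.single i 1) - decay r n) * ψ (n - Pi.single i 1)) =
        -∑ i, (decay r (n + Pi.single i 1) * ψ (n + Pi.single i 1) +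
          decay r (n - Pi.single i 1) * ψ (n - Pi.single i 1)) +
        D.potential ω n * (decay r n * ψ n) - E * (decay r n * ψ n) := by
      have h1 : E * (decay r n * ψ n) = decay r n * (E * ψ n) := by ring
      rw [h1, ← hE, mul_add, mul_neg, Finset.mul_sum]
      have h2 : ∀ i : Fin d, (decay r (n + Pi.single i 1) - decay r n) * ψ (n + Pi.single i 1) +
          (decay r (n - Pi.single i 1) - decay r n) * ψ (n - Pi.single i 1) =
          decay r (n + Pi.single i 1) * ψ (n + Pi.single i 1) +
          decay r (n - Pi.single i 1) * ψ (n - Pi.single i 1) -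
          decay r n * (ψ (n + Pi.single i 1) + ψ (n - Pi.single i 1)) := fun i => by ring
      simp only [h2, Finset.sum_sub_distrib]
      ring
    rw [hreal, lp.coeFn_sub, lp.coeFn_smul, Pi.sub_apply, Pi.smul_apply, hamiltonian_apply,
      smul_eq_mul]
    simp only [huapp]
    push_cast
    rfl
  have hψsum : ∑ i, (ψ (n + Pi.single i 1) + ψ (n - Pi.single i 1)) ≤ (K + |E|) * ψ n := by
    have h1 := hE n
    have h2 := mul_le_mul_of_nonneg_right ((le_abs_self _).trans (hK ω n)) (hpos n).le
    have h3 := mul_le_mul_of_nonneg_right (neg_abs_le E) (hpos n).le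
    linarith
  have hdn := decay_pos hr0 n
  rw [hval, huapp, Complex.norm_real, Complex.norm_real, Real.norm_eq_abs, Real.norm_eq_abs,
    abs_neg, abs_of_pos (mul_pos hdn (hpos n))]
  calc |∑ i, ((decay r (n + Pi.single i 1) - decay r n) * ψ (n + Pi.single i 1) +
        (decay r (n - Pi.single i 1) - decay r n) * ψ (n - Pi.single i 1))|
      ≤ ∑ i, (δ * decay r n) * (ψ (n + Pi.single i 1) + ψ (n - Pi.single i 1)) := by
        refine (Finset.abs_sum_le_sum_abs _ _).trans (Finset.sum_le_sum fun i _ => ?_)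
        refine (abs_add_le _ _).trans ?_
        rw [abs_mul, abs_mul, abs_of_pos (hpos _), abs_of_pos (hpos _), mul_add]
        have hdown := abs_decay_sub_le hδ n i (s := -1) (Or.inr rfl)
        rw [Pi.single_neg, ← sub_eq_add_neg] at hdown
        exact add_le_add
          (mul_le_mul_of_nonneg_right (abs_decay_sub_le hδ n i (Or.inl rfl)) (hpos _).le)
          (mul_le_mul_of_nonneg_right hdown (hpos _).le)
    _ = (δ * decay r n) * ∑ i, (ψ (n + Pi.single i 1) + ψ (n - Pi.single i 1)) :=
        (Finset.mul_sum _ _ _).symm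
    _ ≤ (δ * decay r n) * ((K + |E|) * ψ n) :=
        mul_le_mul_of_nonneg_left hψsum (mul_pos hδ hdn).le
    _ = (δ * (K + |E|)) * (decay r n * ψ n) := by ring
    _ ≤ ε * (decay r n * ψ n) := by
        refine mul_le_mul_of_nonneg_right ?_ (mul_pos hdn (hpos n)).le
        rw [hδdef, div_mul_eq_mul_div, div_le_iff₀ (by positivity)]
        exact mul_le_mul_of_nonneg_left (by linarith) hε.le

/-! ### The configuration `ω*` -/

/-- Symmetry of `q` under reflections in several coordinates at once. -/
theorem ReflectionSymmetric.apply_ite (hH1 : D.ReflectionSymmetric) (S : Finset (Fin d))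
    (x : Lattice d) : D.q (fun i => if i ∈ S then (D.b i : ℤ) - x i + 1 else x i) = D.q x := by
  induction S using Finset.induction_on with
  | empty => simp
  | insert j S hj ih =>
    rw [← ih, hH1 (fun i => if i ∈ S then (D.b i : ℤ) - x i + 1 else x i) j]
    congr 1
    ext i
    by_cases hi : i = j
    · subst hi; simp [hj]
    · simp [hi]

/-- The potential of `ω*` arises from the single box at the corner `0` of the tile by repeated
reflection. -/
theorem potential_omegaStar (hH1 : D.ReflectionSymmetric) (n : Lattice d) :
    D.potential D.omegaStar n = D.translate 0 (D.foldTile n) := by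
  obtain ⟨k, hk⟩ : ∃ k, D.tileIndex n = k := ⟨_, rfl⟩
  have ht := D.tileIndex_eq_iff.1 hk
  have hn : n = D.corner k + (n - D.corner k) := by abel
  generalize n - D.corner k = t at ht hn
  subst hn
  rw [D.potential_corner_add _ _ ht, translate, translate, sub_zero,
    ← hH1.apply_ite (Finset.univ.filter fun i => ¬ Even (k i))]
  congr 1
  ext i
  have hti := D.mem_tile.1 ht i
  simp only [foldTile, corner, Pi.add_apply, fold_mul_add hti.1 hti.2, Finset.mem_filter,
    Finset.mem_univ, true_and, Pi.sub_apply, omegaStar]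
  split_ifs <;> omega

theorem E₀_zero_mem_spec (hH1 : D.ReflectionSymmetric) : D.E₀ 0 ∈ D.spec D.omegaStar := by
  obtain ⟨ψ, hpos, hψ, hE⟩ := D.exists_groundState (D.translate 0)
  refine mem_spec_of_pos_solution (C := ∑ t ∈ D.tile, ψ t) hpos (fun n => ?_) fun n => ?_
  · rw [← hψ n]
    exact Finset.single_le_sum (fun t _ => (hpos t).le) (D.foldTile_mem n)
  · rw [potential_omegaStar hH1]
    exact hE n

theorem isSpectrallyMinimizing_omegaStar (hH1 : D.ReflectionSymmetric) :
    D.IsSpectrallyMinimizing D.omegaStar := by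
  have hlow : ∀ ω : D.Config, ∀ x ∈ D.spec ω, D.E₀ 0 ≤ x := fun ω x hx =>
    le_of_mem_spectrum_of_le_inner (D.isSelfAdjoint_hamiltonian ω)
      (D.le_inner_hamiltonian (fun a ha => E₀_zero_le hH1 ha) ω) (D.mem_spec_iff.1 hx)
  have hleast : IsLeast (D.spec D.omegaStar) (D.E₀ 0) := ⟨E₀_zero_mem_spec hH1, hlow _⟩
  refine ⟨D.exists_isLeast_spec, D.E₀ 0, IsLeast.isGLB ⟨⟨_, hleast⟩, ?_⟩, hleast⟩
  rintro x ⟨ω, hω⟩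
  exact hlow ω x hω.1

/-! ### From minimizing to maximizing -/

/-- The model with the sign of the single-site potential reversed. -/
def flip (D : Model d) : Model d where
  M := D.M
  b := D.b
  one_le_b := D.one_le_b
  b_le_M := D.b_le_M
  q := -D.q
  q_supp x hx := D.q_supp x (neg_ne_zero.1 hx)

/-- The staggering operator `u ↦ (-1)^(n_1 + … + n_d) u(n)`. -/
def stagger (d : ℕ) : Hilb d →L[ℂ] Hilb d :=
  lp.mapCLM 2 (K := 1)
    (fun n => (((∑ i, n i).negOnePow : ℤ) : ℂ) • ContinuousLinearMap.id ℂ ℂ) zero_le_one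
    fun n => by
      rw [norm_smul, ContinuousLinearMap.norm_id, mul_one]
      rcases Int.units_eq_one_or (∑ i, n i).negOnePow with h | h <;> simp [h]

theorem stagger_apply (u : Hilb d) (n : Lattice d) :
    stagger d u n = ((∑ i, n i).negOnePow : ℤ) * u n := rfl

theorem stagger_mul_self : stagger d * stagger d = 1 := by
  ext u n
  change stagger d (stagger d u) n = u n
  rw [stagger_apply, stagger_apply]
  rcases Int.units_eq_one_or (∑ i, n i).negOnePow with h | h <;> simp [h]

theorem potential_flip (ω : D.Config) (n : Lattice d) :
    D.flip.potential ω n = -D.potential ω n :=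
  finsum_neg_distrib fun k => D.translate (D.position ω k) n

/-- Staggering turns `h₀ + V_ω` into `-(h₀ - V_ω)`. -/
theorem stagger_mul_hamiltonian_mul_stagger (ω : D.Config) :
    stagger d * D.hamiltonian ω * stagger d = -D.flip.hamiltonian ω := by
  ext u n
  change stagger d (D.hamiltonian ω (stagger d u)) n = -D.flip.hamiltonian ω u n
  have hsum : ∀ i : Fin d, ∑ j, (n + Pi.single i 1 : Lattice d) j = ∑ j, n j + 1 := fun i => by
    simp [Finset.sum_add_distrib]
  have hsum' : ∀ i : Fin d, ∑ j, (n - Pi.single i 1 : Lattice d) j = ∑ j, n j - 1 := fun i => by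
    simp [Finset.sum_sub_distrib]
  rw [stagger_apply, D.hamiltonian_apply, D.flip.hamiltonian_apply ω, potential_flip]
  simp only [stagger_apply, hsum, hsum', Int.negOnePow_add, Int.negOnePow_sub, Int.negOnePow_one]
  rcases Int.units_eq_one_or (∑ i, n i).negOnePow with h | h
  · simp [h, Finset.sum_add_distrib]
    ring
  · simp [h, Finset.sum_add_distrib]

theorem mem_spec_flip_iff {ω : D.Config} {x : ℝ} : x ∈ D.flip.spec ω ↔ -x ∈ D.spec ω := by
  have hU := spectrum.units_conjugate (R := ℝ) (a := D.hamiltonian ω)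
    (u := ⟨stagger d, stagger d, stagger_mul_self, stagger_mul_self⟩)
  change spectrum ℝ (stagger d * D.hamiltonian ω * stagger d) = D.spec ω at hU
  rw [← hU, stagger_mul_hamiltonian_mul_stagger, ← spectrum.neg_eq, Set.neg_mem_neg]
  rfl

theorem isGreatest_spec_iff {ω : D.Config} {E : ℝ} :
    IsGreatest (D.spec ω) E ↔ IsLeast (D.flip.spec ω) (-E) := by
  rw [IsGreatest, IsLeast, mem_spec_flip_iff, neg_neg]
  refine and_congr_right fun _ => ⟨fun h x hx => ?_, fun h x hx => ?_⟩
  · exact neg_le.1 (h (mem_spec_flip_iff.1 hx))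
  · exact neg_le_neg_iff.1 (h (mem_spec_flip_iff.2 (by rwa [neg_neg])))

theorem isSpectrallyMaximizing_omegaStar (hH1 : D.ReflectionSymmetric) :
    D.IsSpectrallyMaximizing D.omegaStar := by
  have hflip : D.flip.ReflectionSymmetric := fun x i => congrArg Neg.neg (hH1 x i)
  obtain ⟨hex, E, hglb, hleast⟩ := isSpectrallyMinimizing_omegaStar hflip
  refine ⟨fun ω => ?_, -E, IsGreatest.isLUB ⟨⟨D.omegaStar, ?_⟩, ?_⟩, ?_⟩
  · obtain ⟨e, he⟩ := hex ω
    exact ⟨-e, isGreatest_spec_iff.2 (by rwa [neg_neg])⟩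
  · exact isGreatest_spec_iff.2 (by rwa [neg_neg])
  · rintro x ⟨ω, hω⟩
    exact le_neg.1 (hglb.1 ⟨ω, isGreatest_spec_iff.1 hω⟩)
  · exact isGreatest_spec_iff.2 (by rwa [neg_neg])

end Model

end DiscreteDisplacement

end

theorem theorem2p2 {d : ℕ} (D : DiscreteDisplacement.Model d) (hH1 : D.ReflectionSymmetric) :
    ((2 ≤ d ∧ D.SignDefinite ∨ d = 1 ∧ ∃ a ∈ D.Disp, D.E₀ a ≠ -2) →
      D.IsSpectrallyMinimizing D.omegaStar) ∧
    ((2 ≤ d ∧ D.SignDefinite ∨ d = 1 ∧ ∃ a ∈ D.Disp, D.Etilde₀ a ≠ -2) →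
      D.IsSpectrallyMaximizing D.omegaStar) :=
  ⟨fun _ => DiscreteDisplacement.Model.isSpectrallyMinimizing_omegaStar hH1,
    fun _ => DiscreteDisplacement.Model.isSpectrallyMaximizing_omegaStar hH1⟩
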